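/- Let $k\ge 2$ be an integer. A partition $\kappa$ is $k$-bounded if $\kappa_1\le k$. A $(k+1)$-core is a partition without box of hook length $k+1$; deleting the boxes of hook length greater than $k+1$ of a $(k+1)$-core $\lambda$ and left-aligning the rows gives a $k$-bounded partition $\mathfrak p(\lambda)$, and $\mathfrak p$ is a bijection from $(k+1)$-cores to $k$-bounded partitions. For $(k+1)$-cores write $\lambda\to\mu$ if $\lambda\subsetneq\mu$ and all boxes of $\mu/\lambda$ have the same residue (row index minus column index) modulo $k+1$; let $\mathcal B_k$ be the graph on $k$-bounded partitions obtained by transporting these arrows through $\mathfrak p$. For $1\le a\le k$ let $R_a=(k-a+1)^a$ be the rectangle with $a$ parts equal to $k-a+1$. A $k$-bounded partition is irreducible if, for every $1\le i\le k$, it has at most $k-i$ parts equal to $i$; let $\mathcal P_{\mathrm{irr}}$ be the (finite) set of irreducible $k$-bounded partitions. Every $k$-bounded partition $\mu$ is, in a unique way, the union of the parts of an irreducible partition $\widetilde\mu$ and of $p_a^\mu\ge 0$ copies of $R_a$ for $1\le a\le k$. For $r=(r_1,\dots,r_k)\in\mathbb R^k$ and $\lambda,\nu\in\mathcal P_{\mathrm{irr}}$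 put $$\varphi_{\lambda\nu}=\sum_{\lambda\to\mu \text{ in }\mathcal B_k,\ \widetilde\mu=\nu}\ \prod_{a=1}^k r_a^{p_a^\mu},$$ and let $\Phi_r$ be the matrix indexed by $\mathcal P_{\mathrm{irr}}$ with entry $\varphi_{\nu\lambda}$ at position $(\lambda,\nu)$. A square matrix $M$ with nonnegative entries is irreducible if for all indices $i,j$ there is $n\ge 1$ with $(M^n)_{ij}>0$. Let $\Lambda_{(k)}=\mathbb R[h_1,\dots,h_k]$ be the algebra of symmetric functions generated by the complete homogeneous functions $h_1,\dots,h_k$; it contains the Schur functions $s_{R_1},\dots,s_{R_k}$. Let $\varphi:\Lambda_{(k)}\to\mathbb R$ be an $\mathbb R$-algebra morphism with $\varphi(s_{R_a})\ge 0$ for all $1\le a\le k$, and let $\Phi=\Phi_r$ with $r_a=\varphi(s_{R_a})$. Then $\Phi$ is irreducible if and only if, for all $1\le a\le k-1$, $\varphi(s_{R_a})>0$ or $\varphi(s_{R_{a+1}})>0$; the same equivalence holds for the transpose $\Phi^t$. The same also holds for an arbitrary $r\in\mathbb R_{\ge 0}^k$ in place of $(\varphi(s_{R_1}),\dots,\varphi(s_{R_k}))$: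 each of $\Phi_r$ and $\Phi_r^t$ is irreducible if and only if, for all $1\le a\le k-1$, $r_a>0$ or $r_{a+1}>0$. -/

import Mathlib

noncomputable section

/-! ### Cores, `k`-bounded partitions and the graph `B_k`

Partitions are Young diagrams; rows and columns are indexed from `0`. -/

/-- The hook length of the box `c` (arm + leg + 1), meaningful for `c ∈ μ`. -/
def hookLength (μ : YoungDiagram) (c : ℕ × ℕ) : ℕ :=
  (μ.rowLen c.1 - c.2 - 1) + (μ.colLen c.2 - c.1 - 1) + 1

/-- An `l`-core: a partition without box of hook length `l`. -/
def IsCore (l : ℕ) (μ : YoungDiagram) : Prop :=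
  ∀ c ∈ μ, hookLength μ c ≠ l

/-- The residue of a box modulo `l`. -/
def residue (l : ℕ) (c : ℕ × ℕ) : ZMod l :=
  (c.1 : ZMod l) - (c.2 : ZMod l)

/-- The arrows of the graph `C_l` on `l`-cores: `λ ⊊ μ` and all the boxes of `μ / λ` have the
same residue. -/
def CoreArrow (l : ℕ) (lam mu : YoungDiagram) : Prop :=
  IsCore l lam ∧ IsCore l mu ∧ lam < mu ∧
    ∃ i : ZMod l, ∀ c ∈ mu, c ∉ lam → residue l c = i

/-- `κ = 𝔭(λ)`: the partition `κ` is obtained from the `(k+1)`-core `λ` by deleting all the boxes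
of hook length greater than `k + 1` and left-aligning the rows. -/
def IsBoundedOfCore (k : ℕ) (lam kap : YoungDiagram) : Prop :=
  ∀ i : ℕ, kap.rowLen i = ((lam.row i).filter fun c => hookLength lam c ≤ k + 1).card

/-- The arrows of the graph `B_k` on `k`-bounded partitions: the image of the arrows of `C_{k+1}`
under the bijection `𝔭`. -/
def BoundedArrow (k : ℕ) (kap del : YoungDiagram) : Prop :=
  ∃ lam mu : YoungDiagram, IsBoundedOfCore k lam kap ∧ IsBoundedOfCore k mu del ∧
    CoreArrow (k + 1) lam mu

/-! ### Irreducible partitions and the decomposition by rectangles -/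

/-- The number of parts of `μ` equal to `i` (for `1 ≤ i`). -/
def partMult (μ : YoungDiagram) (i : ℕ) : ℕ :=
  μ.rowLens.count i

/-- A `k`-bounded partition is irreducible when it has at most `k - i` parts equal to `i` for all
`1 ≤ i ≤ k`, i.e. when it does not contain the `a` parts of any rectangle
`R_a = (k-a+1)^a`, `1 ≤ a ≤ k`. -/
def IsIrredPartition (k : ℕ) (μ : YoungDiagram) : Prop :=
  μ.rowLen 0 ≤ k ∧ ∀ i, 1 ≤ i → i ≤ k → partMult μ i ≤ k - i

/-- The set of irreducible `k`-bounded partitions (the empty one included). -/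
abbrev IrredPartition (k : ℕ) : Type :=
  {μ : YoungDiagram // IsIrredPartition k μ}

/-- The exponent `p_a` of `μ`, `1 ≤ a ≤ k`: the number of rectangles `R_a = (k-a+1)^a` that can be
removed from the parts of `μ`. -/
def rectExponent (k : ℕ) (μ : YoungDiagram) (a : ℕ) : ℕ :=
  partMult μ (k + 1 - a) / a

/-- `ν` is what remains of the `k`-bounded partition `μ` when all the rectangles are removed:
`μ = ν ∪ R_1^{p_1} ∪ ⋯ ∪ R_k^{p_k}` where `p_a = rectExponent k μ a` and `ν` is irreducible. -/
def IsReduction (k : ℕ) (μ ν : YoungDiagram) : Prop :=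
  IsIrredPartition k ν ∧ ∀ a, 1 ≤ a → a ≤ k →
    partMult μ (k + 1 - a) = partMult ν (k + 1 - a) + rectExponent k μ a * a

/-! ### The matrix `Φ` -/

/-- `φ_{λν} = ∑_{λ → μ, μ̃ = ν} ∏_a r_a ^ p_a(μ)`; the sum is finite because `λ` has only finitely
many successors in `B_k`. -/
def phiEntry (k : ℕ) (r : ℕ → ℝ) (lam nu : YoungDiagram) : ℝ :=
  ∑ᶠ (μ : YoungDiagram) (_ : BoundedArrow k lam μ ∧ IsReduction k μ nu),
    ∏ a ∈ Finset.Icc 1 k, r a ^ rectExponent k μ a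

/-- The matrix `Φ_{(r_1, …, r_k)}`, whose entry at `(λ, ν)` is `φ_{νλ}`. -/
def phiMatrix (k : ℕ) (r : ℕ → ℝ) : Matrix (IrredPartition k) (IrredPartition k) ℝ :=
  Matrix.of fun lam nu => phiEntry k r nu.1 lam.1

/-! ### Symmetric functions -/

/-- The complete homogeneous symmetric function `h_r` in the variables `x_0, x_1, x_2, …`: the sum
of all the monomials of degree `r`. -/
def hFun (r : ℕ) : MvPowerSeries ℕ ℝ :=
  fun m => if m.degree = r then 1 else 0

/-- `h_n` for an integer `n`, with `h_n = 0` for `n < 0`. -/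
def hFunInt (n : ℤ) : MvPowerSeries ℕ ℝ :=
  if 0 ≤ n then hFun n.toNat else 0

/-- The Schur function `s_μ = det (h_{μ_i - i + j})`. -/
def schurFun (μ : YoungDiagram) : MvPowerSeries ℕ ℝ :=
  Matrix.det (Matrix.of fun i j : Fin (μ.colLen 0) =>
    hFunInt ((μ.rowLen (i : ℕ) : ℤ) - ((i : ℕ) : ℤ) + ((j : ℕ) : ℤ)))

/-- `Λ_{(k)}`, the algebra of symmetric functions generated by `h_1, …, h_k`. -/
def LambdaK (k : ℕ) : Subalgebra ℝ (MvPowerSeries ℕ ℝ) :=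
  Algebra.adjoin ℝ {f | ∃ r, 1 ≤ r ∧ r ≤ k ∧ f = hFun r}

/-- The rectangle `R_a = (k-a+1)^a` (used for `1 ≤ a ≤ k`). -/
def rectPartition (k a : ℕ) : YoungDiagram where
  cells := Finset.range a ×ˢ Finset.range (k + 1 - a)
  isLowerSet := by
    intro c d hdc hc
    have h1 : d.1 ≤ c.1 := hdc.1
    have h2 : d.2 ≤ c.2 := hdc.2
    simp only [Finset.coe_product, Finset.coe_range, Set.mem_prod, Set.mem_Iio] at hc ⊢
    omega

lemma hFun_zero : hFun 0 = 1 := by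
  classical
  ext m
  rw [MvPowerSeries.coeff_one]
  simp [hFun, MvPowerSeries.coeff_apply, Finsupp.degree_eq_zero_iff]

lemma hFunInt_mem_LambdaK (k : ℕ) (n : ℤ) (hn : n ≤ k) : hFunInt n ∈ LambdaK k := by
  unfold hFunInt
  split_ifs with h
  · by_cases h0 : n.toNat = 0
    · rw [h0, hFun_zero]
      exact one_mem _
    · exact Algebra.subset_adjoin ⟨n.toNat, by omega, by omega, rfl⟩
  · exact zero_mem _

lemma schurFun_mem_LambdaK (k : ℕ) (μ : YoungDiagram) (h : μ.rowLen 0 + μ.colLen 0 ≤ k + 1) :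
    schurFun μ ∈ LambdaK k := by
  unfold schurFun
  rw [Matrix.det_apply]
  refine sum_mem fun σ _ => ?_
  have hp : ∏ i, (Matrix.of fun i j : Fin (μ.colLen 0) =>
      hFunInt ((μ.rowLen (i : ℕ) : ℤ) - ((i : ℕ) : ℤ) + ((j : ℕ) : ℤ))) (σ i) i ∈ LambdaK k := by
    refine prod_mem fun i _ => ?_
    rw [Matrix.of_apply]
    refine hFunInt_mem_LambdaK k _ ?_
    have h1 := μ.rowLen_anti 0 ((σ i : Fin _) : ℕ) (Nat.zero_le _)
    have h2 := i.2
    omega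
  rcases Int.units_eq_one_or (Equiv.Perm.sign σ) with hs | hs
  · rw [hs, one_smul]
    exact hp
  · rw [hs, Units.neg_smul, one_smul]
    exact neg_mem hp

lemma rectPartition_hook (k a : ℕ) :
    (rectPartition k a).rowLen 0 + (rectPartition k a).colLen 0 ≤ k + 1 := by
  have hmem : ∀ i j, (i, j) ∈ rectPartition k a ↔ i < a ∧ j < k + 1 - a := by
    intro i j
    rw [← YoungDiagram.mem_cells]
    simp [rectPartition]
  have h1 : ∀ j, j < (rectPartition k a).rowLen 0 ↔ 0 < a ∧ j < k + 1 - a := fun j => by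
    rw [← YoungDiagram.mem_iff_lt_rowLen, hmem]
  have h2 : ∀ i, i < (rectPartition k a).colLen 0 ↔ i < a ∧ 0 < k + 1 - a := fun i => by
    rw [← YoungDiagram.mem_iff_lt_colLen, hmem]
  have a1 := h1 (k + 1 - a)
  have a2 := h2 a
  have a3 := h2 0
  omega

/-- The rectangle Schur function `s_{R_a}` as an element of `Λ_{(k)}`. -/
def rectSchur (k a : ℕ) : LambdaK k :=
  ⟨schurFun (rectPartition k a), schurFun_mem_LambdaK k _ (rectPartition_hook k a)⟩

end

/-! Put n = k + 1. On the abacus of an n-core, the beads of each residue class modulo n are the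
integers below a first gap; the sorted first gaps w 0 < ... < w k form a window
(`IsCore.exists_describes`). A row of the k-bounded partition is as long as the number of first gaps
below its bead, so k-bounded partitions are windows up to translation (`Describes.hasWindow`,
`exists_window`, `IsWindow.eq_add_const`). An arrow raises w p and lowers w q by one, where q < p
and w q ≡ w p + 1 (`boundedArrow_iff`).

Irreducible partitions are the tight windows (`isIrredPartition_iff`). An arrow leaves this set
exactly when p = q + 1; it then creates one rectangle R_{k-q}, which is removed by subtracting n
from all w j with j ≥ p (`IsMove.isReduction_iff`, `IsMove.prod_rectExponent`). A tight window is
determined, up to translation, by the cyclic order of its residues, that is by a cyclic word in the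
letters 0, ..., k. On words an arrow turns adjacent letters p, q with p > q into q, p, with weight
1, or r_{k-q} if p = q + 1. Irreducibility is thus connectedness of cyclic words under the exchanges
of nonzero weight.

If r_{k-c} and r_{k-c-1} vanish, neither c + 1, c nor c + 2, c + 1 can be exchanged. In the cyclic
order c, c + 2, c + 1 the letter c + 1 also keeps c + 2 from meeting c, so this order is preserved
forever and its class is absorbing (`IsTwisted.of_phiEntry_pos`). If no two consecutive weights
vanish, induction on the largest letter connects all words (`CyclicStep.reach_of_perm_range`):
either that letter passes every other one, or it is glued in front of the second largest letter, and
the block of both passes the rest. -/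

open YoungDiagram Relation

/-! ### Young diagrams from row lengths and from multiplicities of parts -/

namespace YoungDiagram

lemma exists_rowLen_eq (f : ℕ → ℕ) (hf : Antitone f) (N : ℕ) (hN : f N = 0) :
    ∃ μ : YoungDiagram, ∀ i, μ.rowLen i = f i := by
  have hlt : ∀ i j, j < f i → i < N ∧ j < f 0 := fun i j h => by
    refine ⟨?_, h.trans_le (hf (Nat.zero_le i))⟩
    by_contra hi
    have := hf (not_lt.1 hi)
    omega
  let μ : YoungDiagram :=
    { cells := (Finset.range N ×ˢ Finset.range (f 0)).filter fun c => c.2 < f c.1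
      isLowerSet := by
        intro c d hdc hc
        have h1 : d.1 ≤ c.1 := hdc.1
        have h2 : d.2 ≤ c.2 := hdc.2
        have h3 := hf h1
        simp only [Finset.coe_filter, Finset.mem_product, Finset.mem_range, Set.mem_ofPred_eq]
          at hc ⊢
        have h4 : d.2 < f d.1 := by omega
        exact ⟨hlt _ _ h4, h4⟩ }
  refine ⟨μ, fun i => eq_of_forall_lt_iff fun j => ?_⟩
  rw [← mem_iff_lt_rowLen, ← mem_cells]
  simp only [μ, Finset.mem_filter, Finset.mem_product, Finset.mem_range, and_iff_right_iff_imp]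
  exact hlt i j

lemma ext_rowLen {μ ν : YoungDiagram} (h : ∀ i, μ.rowLen i = ν.rowLen i) : μ = ν := by
  ext ⟨i, j⟩
  rw [mem_cells, mem_cells, mem_iff_lt_rowLen, mem_iff_lt_rowLen, h]

lemma rowLen_eq_zero {μ : YoungDiagram} {i : ℕ} (h : μ.colLen 0 ≤ i) : μ.rowLen i = 0 := by
  by_contra h0
  have := mem_iff_lt_colLen.1 (mem_iff_lt_rowLen.2 (Nat.pos_of_ne_zero h0))
  omega

end YoungDiagram

lemma partMult_eq_card (μ : YoungDiagram) (v : ℕ) :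
    partMult μ v = ((Finset.range (μ.colLen 0)).filter fun i => μ.rowLen i = v).card := by
  rw [partMult, rowLens, List.count, List.countP_map, List.countP_eq_length_filter]
  simp only [Finset.card, Finset.filter, Finset.range, Multiset.range, Multiset.filter_coe,
    Multiset.coe_card]
  congr 1

lemma eq_of_partMult_eq {μ ν : YoungDiagram} (h : ∀ v, 1 ≤ v → partMult μ v = partMult ν v) :
    μ = ν := by
  have hp : μ.rowLens.Perm ν.rowLens := by
    rw [List.perm_iff_count]
    intro v
    rcases Nat.eq_zero_or_pos v with rfl | hv
    · rw [List.count_eq_zero.2 fun h0 => (μ.pos_of_mem_rowLens 0 h0).ne rfl,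
        List.count_eq_zero.2 fun h0 => (ν.pos_of_mem_rowLens 0 h0).ne rfl]
    · exact h v hv
  have he : μ.rowLens = ν.rowLens :=
    hp.eq_of_pairwise (le := (· ≥ ·)) (fun a b _ _ h1 h2 => le_antisymm h2 h1)
      μ.rowLens_sorted.pairwise ν.rowLens_sorted.pairwise
  exact equivListRowLens.injective (Subtype.ext he)

lemma partMult_eq_zero {μ : YoungDiagram} {v : ℕ} (h : μ.rowLen 0 < v) : partMult μ v = 0 := by
  rw [partMult_eq_card, Finset.card_eq_zero, Finset.filter_eq_empty_iff]
  intro i _ hi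
  have := μ.rowLen_anti 0 i (Nat.zero_le _)
  omega

/-! ### Beads and gaps -/

/-- The bead attached to the `i`-th row. -/
def bead (μ : YoungDiagram) (i : ℕ) : ℤ := μ.rowLen i - i

/-- The gap attached to the `j`-th column. -/
def gap (μ : YoungDiagram) (j : ℕ) : ℤ := j + 1 - μ.colLen j

/-- The integer `x` carries a bead of the abacus of `μ`. -/
def IsBead (μ : YoungDiagram) (x : ℤ) : Prop := ∃ i, bead μ i = x

lemma bead_strictAnti (μ : YoungDiagram) : StrictAnti (bead μ) := by
  intro i j h
  have := μ.rowLen_anti i j h.le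
  unfold bead
  omega

lemma gap_strictMono (μ : YoungDiagram) : StrictMono (gap μ) := by
  intro i j h
  have := μ.colLen_anti i j h.le
  unfold gap
  omega

lemma mem_iff_gap_lt_bead {μ : YoungDiagram} {i j : ℕ} : (i, j) ∈ μ ↔ gap μ j < bead μ i := by
  have h1 := @mem_iff_lt_rowLen μ i j
  have h2 := @mem_iff_lt_colLen μ i j
  unfold gap bead
  by_cases h : (i, j) ∈ μ
  · have := h1.1 h
    have := h2.1 h
    simp only [h, true_iff]
    omega
  · have := mt h1.2 h
    have := mt h2.2 h
    simp only [h, false_iff]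
    omega

lemma gap_ne_bead (μ : YoungDiagram) (i j : ℕ) : gap μ j ≠ bead μ i := by
  have h1 := @mem_iff_lt_rowLen μ i j
  have h2 := @mem_iff_lt_colLen μ i j
  unfold gap bead
  by_cases h : (i, j) ∈ μ
  · have := h1.1 h
    have := h2.1 h
    omega
  · have := mt h1.2 h
    have := mt h2.2 h
    omega

/-- The shift by 1 in `gap` makes this exact: bead minus gap is arm plus leg plus 1. -/
lemma hookLength_eq {μ : YoungDiagram} {i j : ℕ} (h : (i, j) ∈ μ) :
    (hookLength μ (i, j) : ℤ) = bead μ i - gap μ j := by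
  have h1 := mem_iff_lt_rowLen.1 h
  have h2 := mem_iff_lt_colLen.1 h
  simp only [hookLength, gap, bead]
  omega

lemma isBead_of_le {μ : YoungDiagram} {x : ℤ} (h : x ≤ -(μ.colLen 0 : ℤ)) : IsBead μ x := by
  refine ⟨(-x).toNat, ?_⟩
  rw [bead, rowLen_eq_zero (by omega)]
  omega

lemma IsBead.le {μ : YoungDiagram} {x : ℤ} (h : IsBead μ x) : x ≤ μ.rowLen 0 := by
  obtain ⟨i, rfl⟩ := h
  have := μ.rowLen_anti 0 i (Nat.zero_le _)
  unfold bead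
  omega

/-- Beads and gaps partition the integers. If i is the first row whose bead lies below x, then i
beads lie above x, and the gap x belongs to the column x - 1 + i, of length i. -/
lemma not_isBead_iff {μ : YoungDiagram} {x : ℤ} : ¬ IsBead μ x ↔ ∃ j, gap μ j = x := by
  constructor
  · intro hx
    have hex : ∃ i, bead μ i < x := by
      refine ⟨μ.colLen 0 + (-x).toNat + 1, ?_⟩
      rw [bead, rowLen_eq_zero (by omega)]
      omega
    classical
    set i := Nat.find hex with hi
    have h1 : bead μ i < x := Nat.find_spec hex
    refine ⟨(x - 1 + i).toNat, ?_⟩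
    have h0 : (0 : ℤ) ≤ x - 1 + i := by
      unfold bead at h1
      omega
    have h2 : ¬ i < μ.colLen (x - 1 + i).toNat := by
      rw [← mem_iff_lt_colLen, mem_iff_lt_rowLen]
      unfold bead at h1
      omega
    have h3 : i ≤ μ.colLen (x - 1 + i).toNat := by
      rcases Nat.eq_zero_or_pos i with h | h
      · omega
      · have h4 : ¬ bead μ (i - 1) < x := Nat.find_min hex (by omega)
        have h5 : bead μ (i - 1) ≠ x := fun h => hx ⟨_, h⟩
        have h6 : (i - 1, (x - 1 + i).toNat) ∈ μ := by
          rw [mem_iff_lt_rowLen]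
          unfold bead at h4 h5
          omega
        have := mem_iff_lt_colLen.1 h6
        omega
    unfold gap
    omega
  · rintro ⟨j, rfl⟩ ⟨i, hi⟩
    exact gap_ne_bead μ i j hi.symm

lemma isCore_iff {n : ℕ} (hn : 0 < n) {μ : YoungDiagram} :
    IsCore n μ ↔ ∀ x, IsBead μ x → IsBead μ (x - n) := by
  constructor
  · rintro h x ⟨i, rfl⟩
    by_contra hx
    obtain ⟨j, hj⟩ := not_isBead_iff.1 hx
    have hm : (i, j) ∈ μ := mem_iff_gap_lt_bead.2 (by omega)
    have := hookLength_eq hm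
    exact h _ hm (by omega)
  · rintro h ⟨i, j⟩ hm hh
    have h1 := hookLength_eq hm
    have h2 : bead μ i - n = gap μ j := by omega
    exact not_isBead_iff.2 ⟨j, h2.symm⟩ (h _ ⟨i, rfl⟩)

/-! ### Windows -/

/-- `w 0 < ⋯ < w (n - 1)` are pairwise incongruent modulo `n`. -/
structure IsWindow (n : ℕ) (w : ℕ → ℤ) : Prop where
  lt : ∀ i j, i < j → j < n → w i < w j
  inj : ∀ i j, i < n → j < n → (n : ℤ) ∣ w i - w j → i = j

/-- `w` lists the first gaps of the residue classes in the abacus of `μ`. -/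
def Describes (n : ℕ) (w : ℕ → ℤ) (μ : YoungDiagram) : Prop :=
  ∀ x, IsBead μ x ↔ ∃ j < n, x < w j ∧ (n : ℤ) ∣ w j - x

lemma eq_of_dvd_of_abs_lt {n a b : ℤ} (h : n ∣ a - b) (h1 : a - b < n) (h2 : b - a < n) :
    a = b := by
  have := Int.eq_zero_of_abs_lt_dvd h (abs_lt.2 ⟨by omega, h1⟩)
  omega

namespace IsWindow

variable {n : ℕ} {w : ℕ → ℤ}

lemma le (hw : IsWindow n w) {i j : ℕ} (h : i ≤ j) (hj : j < n) : w i ≤ w j := by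
  rcases h.eq_or_lt with rfl | h
  · exact le_rfl
  · exact (hw.lt i j h hj).le

lemma lt_of_lt (hw : IsWindow n w) {i j : ℕ} (hi : i < n) (h : w i < w j) : i < j := by
  by_contra hij
  have := hw.le (not_lt.1 hij) hi
  omega

lemma exists_index (hw : IsWindow n w) (hn : 0 < n) (x : ℤ) : ∃ j < n, (n : ℤ) ∣ x - w j := by
  have : NeZero n := ⟨hn.ne'⟩
  have hinj : Function.Injective fun j : Fin n => ((w j : ℤ) : ZMod n) := by
    intro i j hij
    have h1 := (ZMod.intCast_eq_intCast_iff_dvd_sub _ _ n).1 hij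
    exact Fin.ext (hw.inj j i j.2 i.2 h1).symm
  have hb := (Fintype.bijective_iff_injective_and_card _).2 ⟨hinj, by simp [ZMod.card]⟩
  obtain ⟨j, hj⟩ := hb.2 (x : ZMod n)
  exact ⟨j, j.2, (ZMod.intCast_eq_intCast_iff_dvd_sub _ _ n).1 hj⟩

lemma index_unique (hw : IsWindow n w) {x : ℤ} {i j : ℕ} (hi : i < n) (hj : j < n)
    (h1 : (n : ℤ) ∣ x - w i) (h2 : (n : ℤ) ∣ x - w j) : i = j :=
  hw.inj i j hi hj (by simpa using dvd_sub h2 h1)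

lemma add_const (hw : IsWindow n w) (s : ℤ) : IsWindow n fun j => w j + s where
  lt i j h hj := by simpa using hw.lt i j h hj
  inj i j hi hj h := hw.inj i j hi hj (by simpa using h)

end IsWindow

lemma Describes.isBead_iff {n : ℕ} {w : ℕ → ℤ} {μ : YoungDiagram} (hw : IsWindow n w)
    (h : Describes n w μ) {x : ℤ} {j : ℕ} (hj : j < n) (hx : (n : ℤ) ∣ x - w j) :
    IsBead μ x ↔ x < w j := by
  rw [h x]
  constructor
  · rintro ⟨i, hi, h1, h2⟩
    rwa [hw.index_unique hj hi hx ((dvd_sub_comm).1 h2)]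
  · exact fun h1 => ⟨j, hj, h1, dvd_sub_comm.1 hx⟩

/-! ### Cores and their windows of first gaps -/

lemma Describes.isCore {n : ℕ} (hn : 0 < n) {w : ℕ → ℤ} {μ : YoungDiagram}
    (h : Describes n w μ) : IsCore n μ := by
  rw [isCore_iff hn]
  intro x hx
  obtain ⟨j, hj, h1, h2⟩ := (h x).1 hx
  refine (h _).2 ⟨j, hj, by omega, ?_⟩
  have : w j - (x - n) = w j - x + n := by ring
  rw [this]
  exact dvd_add h2 dvd_rfl

lemma IsCore.isBead_sub_mul {n : ℕ} (hn : 0 < n) {μ : YoungDiagram} (h : IsCore n μ) {x : ℤ}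
    (hx : IsBead μ x) (m : ℕ) : IsBead μ (x - n * m) := by
  induction m with
  | zero => simpa using hx
  | succ m ih =>
    have := (isCore_iff hn).1 h _ ih
    convert this using 1
    push_cast
    ring

lemma IsCore.exists_first_gap {n : ℕ} (hn : 0 < n) {μ : YoungDiagram} (h : IsCore n μ) (r : ℤ) :
    ∃ b, (n : ℤ) ∣ b - r ∧ ∀ x, (n : ℤ) ∣ b - x → (IsBead μ x ↔ x < b) := by
  obtain ⟨b, ⟨hb1, hb2⟩, hb3⟩ := Int.exists_least_of_bdd
    (P := fun z => (n : ℤ) ∣ z - r ∧ ¬ IsBead μ z)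
    ⟨-(μ.colLen 0 : ℤ), fun z hz => by
      by_contra hlt
      exact hz.2 (isBead_of_le (by omega))⟩
    -- A point of the class of r beyond `μ.rowLen 0`, which bounds all beads.
    ⟨r + n * (|r| + μ.rowLen 0 + 1), by
      refine ⟨⟨_, add_sub_cancel_left _ _⟩, fun hz => ?_⟩
      have := hz.le
      have h1 : (1 : ℤ) ≤ n := by exact_mod_cast hn
      have h2 := neg_abs_le r
      have h3 := abs_nonneg r
      nlinarith⟩
  refine ⟨b, hb1, fun x hx => ⟨fun hbx => ?_, fun hlt => ?_⟩⟩
  · by_contra hlt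
    obtain ⟨m, hm⟩ := dvd_sub_comm.1 hx
    have hm0 : 0 ≤ m := by
      by_contra hneg
      have h1 : (1 : ℤ) ≤ n := by exact_mod_cast hn
      nlinarith
    have := h.isBead_sub_mul hn hbx m.toNat
    rw [Int.toNat_of_nonneg hm0, ← hm, sub_sub_cancel] at this
    exact hb2 this
  · by_contra hbx
    have h1 : (n : ℤ) ∣ x - r := by simpa using dvd_sub hb1 hx
    have := hb3 x ⟨h1, hbx⟩
    omega

lemma IsCore.exists_describes {n : ℕ} (hn : 0 < n) {μ : YoungDiagram} (h : IsCore n μ) :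
    ∃ w, IsWindow n w ∧ Describes n w μ := by
  choose b hb1 hb2 using fun r : Fin n => h.exists_first_gap hn ((r : ℕ) : ℤ)
  have hbinj : ∀ r s, (n : ℤ) ∣ b r - b s → r = s := by
    intro r s hrs
    have h1 := dvd_add (dvd_sub hrs (hb1 r)) (hb1 s)
    have h2 : (n : ℤ) ∣ ((r : ℕ) : ℤ) - ((s : ℕ) : ℤ) := by
      rwa [show b r - b s - (b r - ((r : ℕ) : ℤ)) + (b s - ((s : ℕ) : ℤ)) =
        ((r : ℕ) : ℤ) - ((s : ℕ) : ℤ) by ring] at h1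
    have h3 := eq_of_dvd_of_abs_lt h2 (by omega) (by omega)
    exact Fin.ext (by exact_mod_cast h3)
  set σ := Tuple.sort b with hσ
  have hmono : Monotone (b ∘ σ) := Tuple.monotone_sort b
  have hstrict : StrictMono (b ∘ σ) := hmono.strictMono_of_injective fun r s hrs =>
    σ.injective (hbinj _ _ (by simp only [Function.comp_apply] at hrs; simp [hrs]))
  refine ⟨fun j => if hj : j < n then b (σ ⟨j, hj⟩) else 0, ⟨?_, ?_⟩, ?_⟩
  · intro i j hij hj
    simp only [hj, hij.trans hj, dif_pos]
    exact hstrict (by exact hij)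
  · intro i j hi hj hd
    simp only [hi, hj, dif_pos] at hd
    simpa using σ.injective (hbinj _ _ hd)
  · intro x
    constructor
    · intro hx
      have hr0 := Int.emod_nonneg x (by omega : (n : ℤ) ≠ 0)
      have hr1 := Int.emod_lt_of_pos x (by omega : (0 : ℤ) < n)
      set r : Fin n := ⟨(x % n).toNat, by omega⟩ with hr
      have hxr : (n : ℤ) ∣ b r - x := by
        have h1 := hb1 r
        have h2 : (n : ℤ) ∣ x - ((r : ℕ) : ℤ) := by
          have : ((r : ℕ) : ℤ) = x % n := by simp [hr, hr0]
          rw [this]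
          exact Int.dvd_self_sub_emod
        simpa using dvd_sub h1 h2
      refine ⟨σ.symm r, (σ.symm r).2, ?_⟩
      simp only [Fin.is_lt, dif_pos, Fin.eta, Equiv.apply_symm_apply]
      exact ⟨(hb2 r x hxr).1 hx, hxr⟩
    · rintro ⟨j, hj, h1, h2⟩
      simp only [hj, dif_pos] at h1 h2
      exact (hb2 _ x h2).2 h1

/-- A box of hook length at most n is a gap at distance at most n below the bead. A residue class
contains exactly one such gap if its first gap lies below the bead, and none otherwise. -/
lemma card_filter_hookLength_eq {n : ℕ} (hn : 0 < n) {w : ℕ → ℤ} (hw : IsWindow n w)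
    {μ : YoungDiagram} (h : Describes n w μ) (i : ℕ) :
    ((μ.row i).filter fun c => hookLength μ c ≤ n).card =
      ((Finset.range n).filter fun j => w j < bead μ i).card := by
  choose idx hidx1 hidx2 using hw.exists_index hn
  have hgap : ∀ j, w (idx (gap μ j)) ≤ gap μ j := fun j => by
    by_contra hlt
    exact not_isBead_iff.2 ⟨j, rfl⟩
      ((h.isBead_iff hw (hidx1 _) (hidx2 _)).2 (not_le.1 hlt))
  have hhook : ∀ c ∈ (μ.row i).filter (fun c => hookLength μ c ≤ n),
      c.1 = i ∧ gap μ c.2 < bead μ i ∧ bead μ i - gap μ c.2 ≤ n := by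
    rintro ⟨a, j⟩ hc
    simp only [Finset.mem_filter, mem_row_iff] at hc
    obtain ⟨⟨hc1, rfl⟩, hc2⟩ := hc
    have := hookLength_eq hc1
    exact ⟨rfl, mem_iff_gap_lt_bead.1 hc1, by dsimp only; omega⟩
  refine Finset.card_bij (fun c _ => idx (gap μ c.2)) ?_ ?_ ?_
  · intro c hc
    have := hhook c hc
    have := hgap c.2
    simp only [Finset.mem_filter, Finset.mem_range]
    exact ⟨hidx1 _, by omega⟩
  · intro c hc d hd hcd
    have h1 := hhook c hc
    have h2 := hhook d hd
    have h3 := dvd_sub (hidx2 (gap μ c.2)) (hidx2 (gap μ d.2))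
    rw [hcd, sub_sub_sub_cancel_right] at h3
    have h4 := eq_of_dvd_of_abs_lt h3 (by omega) (by omega)
    exact Prod.ext (h1.1.trans h2.1.symm) ((gap_strictMono μ).injective h4)
  · intro j hj
    simp only [Finset.mem_filter, Finset.mem_range] at hj
    -- The largest integer below the bead in the class of w j; it is at least w j, hence a gap.
    set x := bead μ i - 1 - (bead μ i - 1 - w j) % n with hx
    have hr0 := Int.emod_nonneg (bead μ i - 1 - w j) (by omega : (n : ℤ) ≠ 0)
    have hr1 := Int.emod_lt_of_pos (bead μ i - 1 - w j) (by omega : (0 : ℤ) < n)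
    have hr2 := Int.mul_ediv_add_emod (bead μ i - 1 - w j) n
    have hr3 : 0 ≤ (n : ℤ) * ((bead μ i - 1 - w j) / n) :=
      mul_nonneg (by omega) (Int.ediv_nonneg (by omega) (by omega))
    have hxd : (n : ℤ) ∣ x - w j := ⟨(bead μ i - 1 - w j) / n, by omega⟩
    have hxb : ¬ IsBead μ x := by
      rw [h.isBead_iff hw hj.1 hxd]
      omega
    obtain ⟨c, hc⟩ := not_isBead_iff.1 hxb
    have hm : (i, c) ∈ μ := mem_iff_gap_lt_bead.2 (by omega)
    refine ⟨(i, c), ?_, ?_⟩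
    · have := hookLength_eq hm
      simp only [Finset.mem_filter, mem_row_iff]
      exact ⟨⟨hm, trivial⟩, by omega⟩
    · dsimp only
      rw [hc]
      exact hw.index_unique (hidx1 _) hj.1 (hidx2 _) hxd

/-! ### Multiplicities of parts read off from windows -/

/-- The number of integers strictly between `w t` and `w (t + 1)` that are congruent modulo `n`
to none of `w 0, …, w t`. -/
noncomputable def windowMult (n : ℕ) (w : ℕ → ℤ) (t : ℕ) : ℕ :=
  ((Finset.Ioo (w t) (w (t + 1))).filter fun x => ∀ j ≤ t, ¬ (n : ℤ) ∣ x - w j).card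

/-- The `k`-bounded partition `κ` corresponds to the window `w`, with `n = k + 1`. -/
structure HasWindow (n : ℕ) (κ : YoungDiagram) (w : ℕ → ℤ) : Prop where
  rowLen_lt : κ.rowLen 0 < n
  partMult_eq : ∀ t, t + 1 < n → partMult κ (t + 1) = windowMult n w t

lemma windowMult_congr {n : ℕ} {w v : ℕ → ℤ} {t : ℕ} (h : ∀ j ≤ t + 1, w j = v j) :
    windowMult n w t = windowMult n v t := by
  unfold windowMult
  rw [h t (by omega), h (t + 1) le_rfl]
  congr 1
  refine Finset.filter_congr fun x _ => forall₂_congr fun j hj => ?_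
  rw [h j (by omega)]

lemma windowMult_add_const (n : ℕ) (w : ℕ → ℤ) (s : ℤ) (t : ℕ) :
    windowMult n (fun j => w j + s) t = windowMult n w t := by
  refine Finset.card_bij' (fun x _ => x - s) (fun x _ => x + s) ?_ ?_ (by simp) (by simp)
  · intro x hx
    simp only [Finset.mem_filter, Finset.mem_Ioo] at hx ⊢
    refine ⟨by omega, fun j hj => ?_⟩
    have := hx.2 j hj
    rwa [show x - (w j + s) = x - s - w j by ring] at this
  · intro x hx
    simp only [Finset.mem_filter, Finset.mem_Ioo] at hx ⊢
    refine ⟨by omega, fun j hj => ?_⟩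
    rw [add_sub_add_right_eq_sub]
    exact hx.2 j hj

lemma HasWindow.congr {n : ℕ} {κ : YoungDiagram} {w v : ℕ → ℤ} (h : HasWindow n κ w) {s : ℤ}
    (hv : ∀ j < n, v j = w j + s) : HasWindow n κ v where
  rowLen_lt := h.rowLen_lt
  partMult_eq t ht := by
    rw [h.partMult_eq t ht, ← windowMult_add_const n w s]
    exact windowMult_congr fun j hj => (hv j (by omega)).symm

lemma HasWindow.unique {n : ℕ} {κ κ' : YoungDiagram} {w : ℕ → ℤ} (h : HasWindow n κ w)
    (h' : HasWindow n κ' w) : κ = κ' := by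
  refine eq_of_partMult_eq fun v hv => ?_
  obtain ⟨t, rfl⟩ : ∃ t, v = t + 1 := ⟨v - 1, by omega⟩
  by_cases ht : t + 1 < n
  · rw [h.partMult_eq t ht, h'.partMult_eq t ht]
  · rw [partMult_eq_zero (by have := h.rowLen_lt; omega),
      partMult_eq_zero (by have := h'.rowLen_lt; omega)]

namespace IsWindow

variable {n : ℕ} {w : ℕ → ℤ}

/-- A full period meets each class once, and the classes of w (t + 1), ..., w (n - 1) remain. With n
= k + 1 this number is k - t, the number of parts t + 1 in one rectangle. -/
lemma card_filter_period (hw : IsWindow n w) {t : ℕ} (ht : t < n) (y : ℤ) :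
    ((Finset.Ico y (y + n)).filter fun x => ∀ j ≤ t, ¬ (n : ℤ) ∣ x - w j).card = n - 1 - t := by
  have hn : 0 < n := by omega
  choose idx hidx1 hidx2 using hw.exists_index hn
  rw [show n - 1 - t = (Finset.Ioo t n).card by rw [Nat.card_Ioo]; omega]
  refine Finset.card_bij (fun x _ => idx x) ?_ ?_ ?_
  · intro x hx
    simp only [Finset.mem_filter, Finset.mem_Ico] at hx
    rw [Finset.mem_Ioo]
    refine ⟨?_, hidx1 x⟩
    by_contra hlt
    exact hx.2 _ (not_lt.1 hlt) (hidx2 x)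
  · intro x hx y hy hxy
    simp only [Finset.mem_filter, Finset.mem_Ico] at hx hy
    have h3 := dvd_sub (hidx2 x) (hidx2 y)
    rw [hxy, sub_sub_sub_cancel_right] at h3
    exact eq_of_dvd_of_abs_lt h3 (by omega) (by omega)
  · intro j hj
    rw [Finset.mem_Ioo] at hj
    have hr0 := Int.emod_nonneg (w j - y) (by omega : (n : ℤ) ≠ 0)
    have hr1 := Int.emod_lt_of_pos (w j - y) (by omega : (0 : ℤ) < n)
    have hd : (n : ℤ) ∣ y + (w j - y) % n - w j := by
      have := (Int.dvd_self_sub_emod (x := w j - y) (m := n)).neg_right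
      rwa [show -(w j - y - (w j - y) % n) = y + (w j - y) % n - w j by ring] at this
    refine ⟨y + (w j - y) % n, ?_, hw.index_unique (hidx1 _) hj.2 (hidx2 _) hd⟩
    simp only [Finset.mem_filter, Finset.mem_Ico]
    refine ⟨by omega, fun i hi hid => ?_⟩
    have := hw.index_unique (by omega) hj.2 hid hd
    omega

lemma not_dvd_of_le (hw : IsWindow n w) {t : ℕ} (ht : t + 1 < n) :
    ∀ j ≤ t, ¬ (n : ℤ) ∣ w (t + 1) - w j := fun j hj hd => by
  have := hw.inj _ _ ht (by omega) hd
  omega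

lemma windowMult_lt (hw : IsWindow n w) {t : ℕ} (ht : t + 1 < n) (h : w (t + 1) - w t < n) :
    windowMult n w t < n - 1 - t := by
  rw [← hw.card_filter_period (by omega : t < n) (w t)]
  apply Finset.card_lt_card
  rw [Finset.ssubset_iff_of_subset]
  · refine ⟨w (t + 1), ?_, by simp⟩
    simp only [Finset.mem_filter, Finset.mem_Ico]
    have := hw.lt t (t + 1) (by omega) ht
    exact ⟨by omega, hw.not_dvd_of_le ht⟩
  · intro x hx
    simp only [Finset.mem_filter, Finset.mem_Ico, Finset.mem_Ioo] at hx ⊢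
    exact ⟨by omega, hx.2⟩

lemma le_windowMult (hw : IsWindow n w) {t : ℕ} (ht : t + 1 < n) (h : (n : ℤ) ≤ w (t + 1) - w t) :
    n - 1 - t ≤ windowMult n w t := by
  rw [← hw.card_filter_period (by omega : t < n) (w t)]
  apply Finset.card_le_card
  intro x hx
  simp only [Finset.mem_filter, Finset.mem_Ico, Finset.mem_Ioo] at hx ⊢
  refine ⟨⟨lt_of_le_of_ne hx.1.1 ?_, by omega⟩, hx.2⟩
  rintro rfl
  exact hx.2 t le_rfl (by simp)

lemma windowMult_add_period (hw : IsWindow n w) {v : ℕ → ℤ} {t : ℕ} (ht : t + 1 < n)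
    (h : ∀ j ≤ t, v j = w j) (h' : v (t + 1) = w (t + 1) + n) :
    windowMult n v t = windowMult n w t + (n - 1 - t) := by
  rw [← hw.card_filter_period (by omega : t < n) (w (t + 1)), windowMult, windowMult,
    h t le_rfl, h', ← Finset.card_union_of_disjoint]
  · congr 1
    have hlt := hw.lt t _ (by omega) ht
    rw [← Finset.filter_union,
      show Finset.Ioo (w t) (w (t + 1)) ∪ Finset.Ico (w (t + 1)) (w (t + 1) + n) =
        Finset.Ioo (w t) (w (t + 1) + n) by
        ext x
        simp only [Finset.mem_union, Finset.mem_Ioo, Finset.mem_Ico]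
        omega]
    refine Finset.filter_congr fun x _ => forall₂_congr fun j hj => ?_
    rw [h j hj]
  · refine Finset.disjoint_filter_filter (Finset.disjoint_left.2 fun x hx hx' => ?_)
    rw [Finset.mem_Ioo] at hx
    rw [Finset.mem_Ico] at hx'
    omega

/-- If v (t + 1) were larger, the interval for v would contain everything counted for w and also w
(t + 1) itself. -/
lemma le_of_windowMult_le {v : ℕ → ℤ} (hw : IsWindow n w) {t : ℕ}
    (ht : t + 1 < n) (h : ∀ j ≤ t, v j = w j) (hc : windowMult n v t ≤ windowMult n w t) :
    v (t + 1) ≤ w (t + 1) := by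
  by_contra! hlt
  refine absurd hc (not_le.2 (Finset.card_lt_card ?_))
  rw [Finset.ssubset_iff_of_subset]
  · refine ⟨w (t + 1), ?_, by simp⟩
    simp only [Finset.mem_filter, Finset.mem_Ioo]
    refine ⟨⟨?_, hlt⟩, fun j hj => ?_⟩
    · rw [h t le_rfl]
      exact hw.lt t _ (by omega) ht
    · rw [h j hj]
      exact hw.not_dvd_of_le ht j hj
  · intro x hx
    simp only [Finset.mem_filter, Finset.mem_Ioo] at hx ⊢
    refine ⟨by rw [h t le_rfl]; omega, fun j hj => ?_⟩
    rw [h j hj]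
    exact hx.2 j hj

/-- A window is determined up to translation by its multiplicities. -/
lemma eq_add_const {v : ℕ → ℤ} (hw : IsWindow n w) (hv : IsWindow n v)
    (h : ∀ t, t + 1 < n → windowMult n v t = windowMult n w t) :
    ∀ j < n, v j = w j + (v 0 - w 0) := by
  have hs := hw.add_const (v 0 - w 0)
  intro j
  induction j using Nat.strong_induction_on with
  | _ j ih =>
    intro hj
    rcases j with _ | t
    · ring
    · have hc := h t hj
      rw [← windowMult_add_const n w (v 0 - w 0)] at hc
      have h1 : ∀ i ≤ t, v i = w i + (v 0 - w 0) := fun i hi => ih i (by omega) (by omega)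
      exact le_antisymm (hs.le_of_windowMult_le hj h1 hc.le)
        (hv.le_of_windowMult_le hj (fun i hi => (h1 i hi).symm) hc.ge)

lemma card_filter_lt_iff (hw : IsWindow n w) {t : ℕ} (ht : t + 1 < n) (x : ℤ) :
    ((Finset.range n).filter fun j => w j < x).card = t + 1 ↔ w t < x ∧ x ≤ w (t + 1) := by
  constructor
  · intro h
    constructor
    · by_contra! hx
      have : (Finset.range n).filter (fun j => w j < x) ⊆ Finset.range t := fun j hj => by
        simp only [Finset.mem_filter, Finset.mem_range] at hj ⊢
        exact hw.lt_of_lt hj.1 (by omega)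
      have := Finset.card_le_card this
      rw [Finset.card_range] at this
      omega
    · by_contra! hx
      have : Finset.range (t + 2) ⊆ (Finset.range n).filter (fun j => w j < x) := fun j hj => by
        simp only [Finset.mem_filter, Finset.mem_range] at hj ⊢
        have := hw.le (show j ≤ t + 1 by omega) ht
        exact ⟨by omega, by omega⟩
      have := Finset.card_le_card this
      rw [Finset.card_range] at this
      omega
  · rintro ⟨h1, h2⟩
    rw [← Finset.card_range (t + 1)]
    congr 1
    ext j
    simp only [Finset.mem_filter, Finset.mem_range]
    constructor
    · rintro ⟨h3, h4⟩
      exact hw.lt_of_lt h3 (by omega)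
    · intro h3
      have := hw.le (show j ≤ t by omega) (by omega)
      exact ⟨by omega, by omega⟩

/-- Every window describes a core, up to translation. -/
lemma exists_describes (hw : IsWindow n w) (hn : 0 < n) :
    ∃ (μ : YoungDiagram) (s : ℤ), Describes n (fun j => w j + s) μ := by
  classical
  set B : ℤ → Prop := fun x => ∃ j < n, x < w j ∧ (n : ℤ) ∣ w j - x with hB
  set M := w (n - 1) with hM
  have hBM : ∀ x, B x → x < M := by
    rintro x ⟨j, hj, h1, -⟩
    have := hw.le (show j ≤ n - 1 by omega) (by omega)
    omega
  have hB0 : ∀ x, x < w 0 → B x := by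
    intro x hx
    obtain ⟨j, hj, hd⟩ := hw.exists_index hn x
    have := hw.le (Nat.zero_le j) hj
    exact ⟨j, hj, by omega, dvd_sub_comm.1 hd⟩
  set P : ℕ → Prop := fun t => B (M - t) with hP
  set T : ℕ := (M - w 0 + 1).toNat with hT
  have hPT : ∀ t, T ≤ t → P t := fun t ht => hB0 _ (by omega)
  have hinf : (Set.ofPred P).Infinite :=
    (Set.Ici_infinite T).mono fun t ht => hPT t ht
  -- Positions are read downwards from M. C is the number of gaps below M, finite because all
  -- positions from T on are beads; the i-th row length is the number of gaps below the i-th bead.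
  -- The translation C - M gives the beads the normalization of a partition.
  set C := Nat.count (fun t => ¬ P t) T with hC
  have hCeq : ∀ y, T ≤ y → Nat.count (fun t => ¬ P t) y = C := by
    intro y hy
    obtain ⟨d, rfl⟩ := Nat.exists_eq_add_of_le hy
    rw [Nat.count_add, ← hC, Nat.add_eq_left, Nat.count_eq_card_filter_range,
      Finset.card_eq_zero, Finset.filter_eq_empty_iff]
    intro i _ hi
    exact hi (hPT _ (by omega))
  have hCle : ∀ y, Nat.count (fun t => ¬ P t) y ≤ C := by
    intro y
    rcases le_total y T with h | h
    · exact Nat.count_monotone _ h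
    · exact (hCeq y h).le
  have hnth : ∀ i, i + Nat.count (fun t => ¬ P t) (Nat.nth P i) = Nat.nth P i := by
    intro i
    have h1 := Nat.count_nth_of_infinite hinf i
    have h2 : ∀ y, Nat.count P y + Nat.count (fun t => ¬ P t) y = y := by
      intro y
      rw [Nat.count_eq_card_filter_range, Nat.count_eq_card_filter_range,
        Finset.card_filter_add_card_filter_not, Finset.card_range]
    have h3 := h2 (Nat.nth P i)
    omega
  obtain ⟨μ, hμ⟩ := exists_rowLen_eq (fun i => C - Nat.count (fun t => ¬ P t) (Nat.nth P i))
    (fun i j hij => Nat.sub_le_sub_left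
      (Nat.count_monotone _ ((Nat.nth_strictMono hinf).monotone hij)) _) T (by
      have := hCeq _ ((Nat.nth_strictMono hinf).le_apply (x := T))
      omega)
  have hbead : ∀ i, bead μ i = C - Nat.nth P i := by
    intro i
    have h1 := hnth i
    have h2 := hCle (Nat.nth P i)
    rw [bead, hμ]
    omega
  refine ⟨μ, C - M, fun x => ?_⟩
  have key : IsBead μ x ↔ B (x + M - C) := by
    constructor
    · rintro ⟨i, hi⟩
      have h1 : P (Nat.nth P i) := Nat.nth_mem_of_infinite hinf i
      rw [hbead] at hi
      simp only [hP] at h1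
      rwa [show x + M - C = M - (Nat.nth P i : ℕ) by omega]
    · intro hx
      have h1 := hBM _ hx
      have h2 : P ((C : ℤ) - x).toNat := by
        simp only [hP]
        rwa [show M - (((C : ℤ) - x).toNat : ℕ) = x + M - C by omega]
      refine ⟨Nat.count P ((C : ℤ) - x).toNat, ?_⟩
      rw [hbead, Nat.nth_count h2]
      omega
  rw [key]
  refine exists_congr fun j => and_congr_right fun hj => ?_
  change x + M - C < w j ∧ (n : ℤ) ∣ w j - (x + M - C) ↔
    x < w j + (C - M) ∧ (n : ℤ) ∣ w j + (C - M) - x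
  rw [show w j + (C - M) - x = w j - (x + M - C) by ring]
  exact and_congr_left fun _ => ⟨fun h => by omega, fun h => by omega⟩

end IsWindow

/-! ### From the window of a core to its bounded partition -/

namespace Describes

variable {k : ℕ} {w : ℕ → ℤ} {μ κ : YoungDiagram}

lemma exists_isBoundedOfCore (hw : IsWindow (k + 1) w) (h : Describes (k + 1) w μ) :
    ∃ κ, IsBoundedOfCore k μ κ := by
  obtain ⟨κ, hκ⟩ := exists_rowLen_eq
    (fun i => ((Finset.range (k + 1)).filter fun j => w j < bead μ i).card)
    (fun i j hij => Finset.card_le_card fun a ha => by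
      have := (bead_strictAnti μ).antitone hij
      simp only [Finset.mem_filter] at ha ⊢
      exact ⟨ha.1, by omega⟩) (μ.colLen 0 + (-w 0).toNat) (by
      rw [Finset.card_eq_zero, Finset.filter_eq_empty_iff]
      intro j hj
      have := hw.le (Nat.zero_le j) (Finset.mem_range.1 hj)
      rw [bead, rowLen_eq_zero (by omega)]
      omega)
  exact ⟨κ, fun i => by rw [hκ, card_filter_hookLength_eq (Nat.succ_pos k) hw h]⟩

/-- The rows of length t + 1 have their beads between w t and w (t + 1). In that interval the beads
are the integers whose class has its first gap at some w j with j > t, as counted by `windowMult`.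
-/
lemma hasWindow (hw : IsWindow (k + 1) w) (h : Describes (k + 1) w μ)
    (hκ : IsBoundedOfCore k μ κ) : HasWindow (k + 1) κ w := by
  have hrow : ∀ i, κ.rowLen i = ((Finset.range (k + 1)).filter fun j => w j < bead μ i).card :=
    fun i => by rw [hκ i, card_filter_hookLength_eq (Nat.succ_pos k) hw h]
  constructor
  · rw [hrow]
    obtain ⟨j, hj, h1, -⟩ := (h _).1 ⟨0, rfl⟩
    calc _ < (Finset.range (k + 1)).card := by
          apply Finset.card_lt_card
          rw [Finset.ssubset_iff_of_subset (Finset.filter_subset _ _)]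
          refine ⟨j, Finset.mem_range.2 hj, ?_⟩
          simp only [Finset.mem_filter, not_and]
          omega
      _ = k + 1 := Finset.card_range _
  · intro t ht
    rw [partMult_eq_card]
    refine Finset.card_bij (fun i _ => bead μ i) ?_ ?_ ?_
    · intro i hi
      simp only [Finset.mem_filter, Finset.mem_range] at hi
      rw [hrow, hw.card_filter_lt_iff ht] at hi
      obtain ⟨j, hj, h1, h2⟩ := (h _).1 ⟨i, rfl⟩
      simp only [Finset.mem_filter, Finset.mem_Ioo]
      refine ⟨⟨hi.2.1, lt_of_le_of_ne hi.2.2 fun heq => ?_⟩, fun a ha hd => ?_⟩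
      · rw [heq] at h1 h2
        have := hw.inj _ _ hj ht h2
        rw [this] at h1
        exact lt_irrefl _ h1
      · have := hw.index_unique (by omega) hj hd (dvd_sub_comm.1 h2)
        subst this
        have := hw.le ha (by omega)
        omega
    · intro i _ j _ hij
      exact (bead_strictAnti μ).injective hij
    · intro x hx
      simp only [Finset.mem_filter, Finset.mem_Ioo] at hx
      obtain ⟨j, hj, hd⟩ := hw.exists_index (Nat.succ_pos k) x
      have h1 : t + 1 ≤ j := by
        by_contra hlt
        exact hx.2 j (by omega) hd
      have h2 := hw.le h1 hj
      obtain ⟨i, rfl⟩ := (h x).2 ⟨j, hj, by omega, dvd_sub_comm.1 hd⟩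
      have h3 : κ.rowLen i = t + 1 := by
        rw [hrow, hw.card_filter_lt_iff ht]
        omega
      refine ⟨i, ?_, rfl⟩
      simp only [Finset.mem_filter, Finset.mem_range]
      refine ⟨?_, h3⟩
      by_contra hlt
      have := rowLen_eq_zero (not_lt.1 hlt)
      omega

end Describes

lemma IsWindow.exists_hasWindow {k : ℕ} {w : ℕ → ℤ} (hw : IsWindow (k + 1) w) :
    ∃ κ, HasWindow (k + 1) κ w := by
  obtain ⟨μ, s, hμ⟩ := hw.exists_describes (Nat.succ_pos k)
  obtain ⟨κ, hκ⟩ := hμ.exists_isBoundedOfCore (hw.add_const s)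
  exact ⟨κ, (hμ.hasWindow (hw.add_const s) hκ).congr (s := -s) fun j _ => by ring⟩

/-! ### Arrows in terms of windows -/

/-- The window obtained from `w` by raising `w p` and lowering `w q` by one. -/
def moveWindow (w : ℕ → ℤ) (p q : ℕ) (j : ℕ) : ℤ :=
  w j + (if j = p then 1 else 0) - (if j = q then 1 else 0)

/-- The pairs `(p, q)` along which a window can be moved. -/
structure IsMove (n : ℕ) (w : ℕ → ℤ) (p q : ℕ) : Prop where
  lt : q < p
  lt' : p < n
  dvd : (n : ℤ) ∣ w p + 1 - w q

lemma not_dvd_one {n : ℕ} (hn : 2 ≤ n) : ¬ (n : ℤ) ∣ 1 := fun h => by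
  have := Int.le_of_dvd one_pos h
  omega

namespace IsMove

variable {n : ℕ} {w : ℕ → ℤ} {p q : ℕ}

lemma two_le (h : IsMove n w p q) : 2 ≤ n := by
  have := h.lt
  have := h.lt'
  omega

lemma moveWindow_left (h : IsMove n w p q) : moveWindow w p q p = w p + 1 := by
  have := h.lt
  simp [moveWindow, this.ne']

lemma moveWindow_right (h : IsMove n w p q) : moveWindow w p q q = w q - 1 := by
  have := h.lt
  simp [moveWindow, this.ne]

lemma moveWindow_of_ne {j : ℕ} (hp : j ≠ p) (hq : j ≠ q) : moveWindow w p q j = w j := by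
  simp [moveWindow, hp, hq]

lemma dvd_moveWindow_sub (h : IsMove n w p q) (j : ℕ) :
    (n : ℤ) ∣ moveWindow w p q j - w (Equiv.swap p q j) := by
  by_cases hp : j = p
  · subst hp
    rw [h.moveWindow_left, Equiv.swap_apply_left]
    exact h.dvd
  · by_cases hq : j = q
    · subst hq
      rw [h.moveWindow_right, Equiv.swap_apply_right, dvd_sub_comm,
        show w p - (w j - 1) = w p + 1 - w j by ring]
      exact h.dvd
    · rw [moveWindow_of_ne hp hq, Equiv.swap_apply_of_ne_of_ne hp hq, sub_self]
      exact dvd_zero _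

lemma swap_lt (h : IsMove n w p q) {j : ℕ} (hj : j < n) : Equiv.swap p q j < n := by
  have := h.lt
  have := h.lt'
  rw [Equiv.swap_apply_def]
  split_ifs <;> omega

/-- The order survives because w p + 1 ≡ w q and w q - 1 ≡ w p cannot collide with an entry of a
third class; modulo n the move only exchanges the classes of p and q. -/
lemma isWindow (h : IsMove n w p q) (hw : IsWindow n w) : IsWindow n (moveWindow w p q) where
  lt i j hij hj := by
    have h1 := h.lt
    have h2 := h.lt'
    have h3 := hw.lt i j hij hj
    have h4 : i = p → w j ≠ w p + 1 := fun _ hj' => by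
      have h5 := h.dvd
      rw [← hj'] at h5
      have := hw.inj _ _ hj (by omega) h5
      omega
    have h5 : j = q → w i ≠ w q - 1 := fun _ hi' => by
      have h5 := h.dvd
      rw [show w p + 1 - w q = w p - (w q - 1) by ring, ← hi'] at h5
      have := hw.inj _ _ (by omega) (by omega) h5
      omega
    unfold moveWindow
    split_ifs <;> subst_vars <;> simp only [forall_const, ne_eq] at h4 h5 <;> omega
  inj i j hi hj hd := by
    have h1 := dvd_sub (dvd_add hd (h.dvd_moveWindow_sub j)) (h.dvd_moveWindow_sub i)
    rw [show moveWindow w p q i - moveWindow w p q j +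
      (moveWindow w p q j - w (Equiv.swap p q j)) -
      (moveWindow w p q i - w (Equiv.swap p q i)) =
      w (Equiv.swap p q i) - w (Equiv.swap p q j) by ring] at h1
    exact (Equiv.swap p q).injective (hw.inj _ _ (h.swap_lt hi) (h.swap_lt hj) h1)

lemma add_const (h : IsMove n w p q) (s : ℤ) : IsMove n (fun j => w j + s) p q where
  lt := h.lt
  lt' := h.lt'
  dvd := by
    rw [show w p + s + 1 - (w q + s) = w p + 1 - w q by ring]
    exact h.dvd

end IsMove

section
open Classical

/-- All beads of the class of w p with a free right neighbour advance by one. These are the x in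
that class with w q - 1 ≤ x < w p, so the class of w p gets first gap w q - 1 and the class of w q
gets w p + 1. -/
lemma Describes.move {n : ℕ} {w : ℕ → ℤ} {p q : ℕ} {lam mu : YoungDiagram}
    (hw : IsWindow n w) (h : Describes n w lam) (hm : IsMove n w p q)
    (hmu : ∀ i, mu.rowLen i = lam.rowLen i +
      if (n : ℤ) ∣ bead lam i - w p ∧ ¬ IsBead lam (bead lam i + 1) then 1 else 0) :
    Describes n (moveWindow w p q) mu := by
  have hn := hm.two_le
  have hqp := hm.lt
  have hpn := hm.lt'
  have h1 := not_dvd_one hn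
  have hbead : ∀ i, bead mu i = bead lam i +
      if (n : ℤ) ∣ bead lam i - w p ∧ ¬ IsBead lam (bead lam i + 1) then 1 else 0 := by
    intro i
    have := hmu i
    unfold bead at this ⊢
    rw [this]
    split_ifs <;> push_cast <;> ring
  have hmem : ∀ y, IsBead mu y ↔
      (IsBead lam y ∧ ¬ ((n : ℤ) ∣ y - w p ∧ ¬ IsBead lam (y + 1))) ∨
      (IsBead lam (y - 1) ∧ (n : ℤ) ∣ y - 1 - w p ∧ ¬ IsBead lam y) := by
    intro y
    constructor
    · rintro ⟨i, rfl⟩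
      rw [hbead]
      split_ifs with hi
      · right
        rw [add_sub_cancel_right]
        exact ⟨⟨i, rfl⟩, hi⟩
      · left
        rw [add_zero]
        exact ⟨⟨i, rfl⟩, hi⟩
    · rintro (⟨⟨i, rfl⟩, hi⟩ | ⟨⟨i, hi⟩, hi2, hi3⟩)
      · exact ⟨i, by rw [hbead, if_neg hi, add_zero]⟩
      · refine ⟨i, ?_⟩
        rw [hbead, hi, if_pos ⟨hi2, by rwa [sub_add_cancel]⟩, sub_add_cancel]
  have hw' := hm.isWindow hw
  intro y
  obtain ⟨j, hj, hd⟩ := hw.exists_index (by omega) y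
  have hRHS : (∃ i < n, y < moveWindow w p q i ∧ (n : ℤ) ∣ moveWindow w p q i - y) ↔
      y < moveWindow w p q (Equiv.swap p q j) := by
    have hd' : (n : ℤ) ∣ y - moveWindow w p q (Equiv.swap p q j) := by
      have := hm.dvd_moveWindow_sub (Equiv.swap p q j)
      rw [Equiv.swap_apply_self] at this
      simpa using dvd_sub hd this
    constructor
    · rintro ⟨i, hi, h2, h3⟩
      rwa [← hw'.index_unique hi (hm.swap_lt hj) (dvd_sub_comm.1 h3) hd']
    · exact fun h2 => ⟨_, hm.swap_lt hj, h2, dvd_sub_comm.1 hd'⟩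
  rw [hRHS, hmem]
  have hy := h.isBead_iff hw hj hd
  have hdvd := hm.dvd
  by_cases hjp : j = p
  · subst hjp
    rw [Equiv.swap_apply_left, hm.moveWindow_right]
    have h2 : ¬ (n : ℤ) ∣ y - 1 - w j := fun h2 => h1 (by simpa using dvd_sub hd h2)
    have h3 : (n : ℤ) ∣ y + 1 - w q := by
      have := dvd_add hd hdvd
      rwa [show y - w j + (w j + 1 - w q) = y + 1 - w q by ring] at this
    have h4 := h.isBead_iff hw (by omega) h3
    have h5 : w q < w j := hw.lt _ _ hqp hpn
    simp only [h2, hd, false_and, and_false, or_false, true_and, not_not, hy, h4]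
    omega
  · by_cases hjq : j = q
    · subst hjq
      rw [Equiv.swap_apply_right, hm.moveWindow_left]
      have h2 : ¬ (n : ℤ) ∣ y - w p := fun h2 => hjp (hw.index_unique hj hpn hd h2)
      have h3 : (n : ℤ) ∣ y - 1 - w p := by
        have := dvd_sub hd hdvd
        rwa [show y - w j - (w p + 1 - w j) = y - 1 - w p by ring] at this
      have h4 := h.isBead_iff hw hpn h3
      have h5 : w j < w p := hw.lt _ _ hqp hpn
      simp only [h2, h3, false_and, not_false_eq_true, and_true, true_and, hy, h4]
      omega
    · rw [Equiv.swap_apply_of_ne_of_ne hjp hjq, IsMove.moveWindow_of_ne hjp hjq]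
      have h2 : ¬ (n : ℤ) ∣ y - w p := fun h2 => hjp (hw.index_unique hj hpn hd h2)
      have h3 : ¬ (n : ℤ) ∣ y - 1 - w p := fun h3 => hjq (by
        have := dvd_add h3 hdvd
        rw [show y - 1 - w p + (w p + 1 - w q) = y - w q by ring] at this
        exact hw.index_unique hj (by omega) hd this)
      simp only [h2, h3, false_and, and_false, or_false, not_false_eq_true, and_true, hy]

lemma residue_eq_residue_iff {n : ℕ} {i j i' j' : ℕ} :
    residue n (i, j) = residue n (i', j') ↔ (n : ℤ) ∣ ((j : ℤ) - i) - (j' - i') := by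
  have h : ∀ a b : ℕ, residue n (a, b) = (((a : ℤ) - b : ℤ) : ZMod n) := fun a b => by
    simp [residue]
  rw [h, h, ZMod.intCast_eq_intCast_iff_dvd_sub]
  rw [show ((i' : ℤ) - j') - (i - j) = ((j : ℤ) - i) - (j' - i') by ring]

lemma Describes.exists_coreArrow {n : ℕ} {w : ℕ → ℤ} {p q : ℕ} {lam : YoungDiagram}
    (hw : IsWindow n w) (h : Describes n w lam) (hm : IsMove n w p q) :
    ∃ mu, Describes n (moveWindow w p q) mu ∧ CoreArrow n lam mu := by
  have hn := hm.two_le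
  have hqp := hm.lt
  have hpn := hm.lt'
  obtain ⟨mu, hmu⟩ := exists_rowLen_eq (fun i => lam.rowLen i +
      if (n : ℤ) ∣ bead lam i - w p ∧ ¬ IsBead lam (bead lam i + 1) then 1 else 0) (by
      refine antitone_nat_of_succ_le fun i => ?_
      have h1 := lam.rowLen_anti i (i + 1) (by omega)
      rcases h1.lt_or_eq with h2 | h2
      · split_ifs <;> omega
      · rw [if_neg (c := (n : ℤ) ∣ bead lam (i + 1) - w p ∧ ¬ IsBead lam (bead lam (i + 1) + 1))]
        · omega
        · rintro ⟨-, h3⟩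
          refine h3 ⟨i, ?_⟩
          unfold bead
          omega) (lam.colLen 0 + 1) (by
      rw [rowLen_eq_zero (by omega), if_neg]
      rintro ⟨-, h3⟩
      refine h3 ⟨lam.colLen 0, ?_⟩
      rw [bead, bead, rowLen_eq_zero (by omega), rowLen_eq_zero (by omega)]
      push_cast
      ring)
  have hdesc := h.move hw hm hmu
  have hle : lam ≤ mu := by
    rintro ⟨i, j⟩ hc
    replace hc := mem_iff_lt_rowLen.1 hc
    refine mem_iff_lt_rowLen.2 ?_
    rw [hmu]
    omega
  refine ⟨mu, hdesc, h.isCore (by omega), hdesc.isCore (by omega), lt_of_le_of_ne hle ?_, ?_⟩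
  -- Some bead really moves: w q - 1 is a bead of the class of w p, and w q is a gap.
  · intro heq
    obtain ⟨i, hi⟩ := (h.isBead_iff hw hpn (x := w q - 1)
      (by rw [dvd_sub_comm, show w p - (w q - 1) = w p + 1 - w q by ring]; exact hm.dvd)).2
      (by have := hw.lt _ _ hqp hpn; omega)
    have h1 := hmu i
    rw [← heq, if_pos] at h1
    · omega
    · rw [hi]
      refine ⟨?_, ?_⟩
      · rw [dvd_sub_comm, show w p - (w q - 1) = w p + 1 - w q by ring]
        exact hm.dvd
      · rw [sub_add_cancel, h.isBead_iff hw (hqp.trans hpn) (by simp)]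
        exact lt_irrefl _
  · have hcell : ∀ i j, (i, j) ∈ mu → (i, j) ∉ lam →
        j = lam.rowLen i ∧ (n : ℤ) ∣ bead lam i - w p := by
      intro i j h1 h2
      rw [mem_iff_lt_rowLen] at h1 h2
      rw [hmu] at h1
      split_ifs at h1 with hi
      · exact ⟨by omega, hi.1⟩
      · omega
    refine ⟨((-w p : ℤ) : ZMod n), ?_⟩
    rintro ⟨i, j⟩ h1 h2
    obtain ⟨rfl, h3⟩ := hcell i j h1 h2
    have h4 : residue n (i, lam.rowLen i) = ((-bead lam i : ℤ) : ZMod n) := by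
      simp [residue, bead]
    rw [h4, ZMod.intCast_eq_intCast_iff_dvd_sub,
      show -w p - -bead lam i = bead lam i - w p by ring]
    exact h3

lemma isBead_of_dvd_of_le {n : ℕ} (hn : 0 < n) {μ : YoungDiagram} (hμ : IsCore n μ) {x y : ℤ}
    (hx : IsBead μ x) (hd : (n : ℤ) ∣ x - y) (hle : y ≤ x) : IsBead μ y := by
  obtain ⟨m, hm⟩ := hd
  have hm0 : 0 ≤ m := by
    by_contra hneg
    have h1 : (1 : ℤ) ≤ n := by exact_mod_cast hn
    nlinarith
  have := hμ.isBead_sub_mul hn hx m.toNat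
  rwa [Int.toNat_of_nonneg hm0, ← hm, sub_sub_cancel] at this

/-- Adding boxes of one residue advances beads of one class by one step. Since the result is a core,
every bead of this class that can advance must do so, hence `Describes.move` applies. -/
lemma CoreArrow.exists_isMove {n : ℕ} (hn : 2 ≤ n) {w : ℕ → ℤ} {lam mu : YoungDiagram}
    (hw : IsWindow n w) (h : Describes n w lam) (ha : CoreArrow n lam mu) :
    ∃ p q, IsMove n w p q ∧ Describes n (moveWindow w p q) mu := by
  obtain ⟨-, hmuc, hlt, c, hc⟩ := ha
  have hone := not_dvd_one hn
  have hle : ∀ i, lam.rowLen i ≤ mu.rowLen i := fun i => by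
    by_contra! h1
    exact lt_irrefl _ (mem_iff_lt_rowLen.1 (hlt.le (mem_iff_lt_rowLen.2 h1)))
  have hres : ∀ i j, lam.rowLen i ≤ j → j < mu.rowLen i → residue n (i, j) = c :=
    fun i j h1 h2 => hc _ (mem_iff_lt_rowLen.2 h2) (by rw [mem_iff_lt_rowLen]; omega)
  have hle1 : ∀ i, mu.rowLen i ≤ lam.rowLen i + 1 := fun i => by
    by_contra! h1
    have h2 := (hres i (lam.rowLen i + 1) (by omega) (by omega)).trans
      (hres i (lam.rowLen i) (by omega) (by omega)).symm
    rw [residue_eq_residue_iff] at h2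
    push_cast at h2
    exact hone (by simpa using h2)
  have hmoved : ∀ i i', lam.rowLen i < mu.rowLen i → lam.rowLen i' < mu.rowLen i' →
      (n : ℤ) ∣ bead lam i - bead lam i' := fun i i' h1 h2 => by
    have := (hres i _ le_rfl h1).trans (hres i' _ le_rfl h2).symm
    rwa [residue_eq_residue_iff] at this
  have hbead : ∀ i, bead mu i = bead lam i ∧ ¬ lam.rowLen i < mu.rowLen i ∨
      bead mu i = bead lam i + 1 ∧ lam.rowLen i < mu.rowLen i := fun i => by
    have h1 := hle i
    have h2 := hle1 i
    unfold bead
    omega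
  have hinj := (bead_strictAnti lam).injective
  obtain ⟨a, hamoved⟩ : ∃ i, lam.rowLen i < mu.rowLen i := by
    by_contra! h1
    exact hlt.ne (ext_rowLen fun i => le_antisymm (hle i) (h1 i))
  obtain ⟨p, hp, hpd⟩ := hw.exists_index (by omega) (bead lam a)
  obtain ⟨q, hq, hqd⟩ := hw.exists_index (by omega) (w p + 1)
  have hres_p : ∀ i, lam.rowLen i < mu.rowLen i → (n : ℤ) ∣ bead lam i - w p := fun i hi => by
    simpa using dvd_add (hmoved i a hi hamoved) hpd
  have hnot : ∀ i, lam.rowLen i < mu.rowLen i → ¬ IsBead lam (bead lam i + 1) := by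
    rintro i hi ⟨b, hb⟩
    rcases hbead b with ⟨h1, h2⟩ | ⟨-, h2⟩
    · rcases hbead i with ⟨-, h3⟩ | ⟨h3, -⟩
      · exact h3 hi
      · have := (bead_strictAnti mu).injective (h1.trans (hb.trans h3.symm))
        subst this
        exact h2 hi
    · have h3 := hmoved b i h2 hi
      rw [hb] at h3
      exact hone (by simpa using h3)
  have hq1 : (n : ℤ) ∣ bead lam a + 1 - w q := by
    have := dvd_add hpd hqd
    rwa [show bead lam a - w p + (w p + 1 - w q) = bead lam a + 1 - w q by ring] at this
  have hqp : q < p := by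
    have h1 := (h.isBead_iff hw hp hpd).1 ⟨a, rfl⟩
    have h2 := mt (h.isBead_iff hw hq hq1).2 (hnot a hamoved)
    have h3 : q ≠ p := by
      rintro rfl
      exact hone (by simpa using hqd)
    have h4 : ¬ p < q := fun h4 => by
      have := hw.lt p q h4 hq
      omega
    omega
  have hm : IsMove n w p q := ⟨hqp, hp, hqd⟩
  refine ⟨p, q, hm, h.move hw hm fun i => ?_⟩
  split_ifs with hi
  · obtain ⟨hi1, hi2⟩ := hi
    have h1 : lam.rowLen i < mu.rowLen i := by
      by_contra hi3
      have hia : i ≠ a := by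
        rintro rfl
        exact hi3 hamoved
      have hd : (n : ℤ) ∣ bead lam i - bead lam a := by simpa using dvd_sub hi1 hpd
      have hmi : bead mu i = bead lam i := by
        rcases hbead i with h1 | h1
        · exact h1.1
        · exact absurd h1.2 hi3
      have hma : bead mu a = bead lam a + 1 := by
        rcases hbead a with h1 | h1
        · exact absurd hamoved h1.2
        · exact h1.1
      -- Bead i could move but stays, while bead a of the same class moves. If i is above a, the
      -- core condition for `mu` demands a bead at the place a has left; if i is below a, it demands
      -- one at the place right of i.
      rcases lt_or_ge (bead lam a) (bead lam i) with hlt' | hge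
      · obtain ⟨b, hb⟩ := isBead_of_dvd_of_le (by omega) hmuc ⟨i, hmi⟩ hd hlt'.le
        rcases hbead b with ⟨h1, h2⟩ | ⟨h1, h2⟩
        · have := hinj (h1.symm.trans hb)
          subst this
          exact h2 hamoved
        · have h3 := hmoved a b hamoved h2
          rw [← hb, h1] at h3
          exact hone (by simpa using h3)
      · obtain ⟨b, hb⟩ := isBead_of_dvd_of_le (y := bead lam i + 1) (by omega) hmuc ⟨a, hma⟩
          (by rw [add_sub_add_right_eq_sub]; exact dvd_sub_comm.1 hd) (by omega)
        rcases hbead b with ⟨h1, h2⟩ | ⟨h1, h2⟩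
        · exact hi2 ⟨b, by omega⟩
        · have := hinj (show bead lam b = bead lam i by omega)
          subst this
          exact hi3 h2
    have := hle1 i
    omega
  · have h1 : ¬ lam.rowLen i < mu.rowLen i := fun h1 => hi ⟨hres_p i h1, hnot i h1⟩
    have := hle i
    omega

end

/-- The arrows of the graph on `k`-bounded partitions, in terms of windows. -/
lemma boundedArrow_iff {k : ℕ} (hk : 1 ≤ k) {w : ℕ → ℤ} (hw : IsWindow (k + 1) w)
    {κ δ : YoungDiagram} (hκ : HasWindow (k + 1) κ w) :
    BoundedArrow k κ δ ↔
      ∃ p q, IsMove (k + 1) w p q ∧ HasWindow (k + 1) δ (moveWindow w p q) := by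
  have hshift : ∀ (s : ℤ) p q, moveWindow (fun j => w j + s) p q =
      fun j => moveWindow w p q j + s := fun s p q => by
    funext j
    unfold moveWindow
    ring
  constructor
  · rintro ⟨lam, mu, h1, h2, h3⟩
    obtain ⟨v, hv, hd⟩ := h3.1.exists_describes (Nat.succ_pos k)
    obtain ⟨p, q, hm, hd'⟩ := h3.exists_isMove (by omega) hv hd
    have hκ' := hd.hasWindow hv h1
    have hδ := hd'.hasWindow (hm.isWindow hv) h2
    have hs := hv.eq_add_const hw fun t ht => by
      rw [← hκ.partMult_eq t ht, ← hκ'.partMult_eq t ht]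
    have hqp := hm.lt
    have hpn := hm.lt'
    refine ⟨p, q, ⟨hqp, hpn, ?_⟩, hδ.congr (s := w 0 - v 0) fun j hj => ?_⟩
    · rw [hs p hpn, hs q (hqp.trans hpn)]
      simpa using (hm.add_const (w 0 - v 0)).dvd
    · unfold moveWindow
      rw [hs j hj]
      ring
  · rintro ⟨p, q, hm, hδ⟩
    obtain ⟨lam, s, hd⟩ := hw.exists_describes (Nat.succ_pos k)
    have hws := hw.add_const s
    have hms := hm.add_const s
    obtain ⟨mu, hd', ha⟩ := hd.exists_coreArrow hws hms
    obtain ⟨κ', hκ'⟩ := hd.exists_isBoundedOfCore hws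
    obtain ⟨δ', hδ'⟩ := hd'.exists_isBoundedOfCore (hms.isWindow hws)
    have e1 : κ' = κ := (hd.hasWindow hws hκ').unique (hκ.congr fun _ _ => rfl)
    have e2 : δ' = δ := (hd'.hasWindow (hms.isWindow hws) hδ').unique
      (hδ.congr (s := s) fun j _ => by rw [hshift])
    subst e1 e2
    exact ⟨lam, mu, hκ', hδ', ha⟩

/-! ### Existence of windows -/

lemma exists_card_filter_Ioo_eq (P : ℤ → Prop) [DecidablePred P] (hP : ∀ x, ∃ y, x < y ∧ P y)
    (a : ℤ) (m : ℕ) : ∃ y, a < y ∧ P y ∧ ((Finset.Ioo a y).filter P).card = m := by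
  have hnext : ∀ x, ∃ y, x < y ∧ P y ∧ ∀ z, x < z → z < y → ¬ P z := fun x => by
    obtain ⟨y, ⟨h1, h2⟩, h3⟩ := Int.exists_least_of_bdd (P := fun y => x < y ∧ P y)
      ⟨x, fun z hz => hz.1.le⟩ (hP x)
    refine ⟨y, h1, h2, fun z hz hzy hPz => ?_⟩
    have := h3 z ⟨hz, hPz⟩
    omega
  induction m with
  | zero =>
    obtain ⟨y, h1, h2, h3⟩ := hnext a
    refine ⟨y, h1, h2, ?_⟩
    rw [Finset.card_eq_zero, Finset.filter_eq_empty_iff]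
    intro z hz
    rw [Finset.mem_Ioo] at hz
    exact h3 z hz.1 hz.2
  | succ m ih =>
    obtain ⟨y, h1, h2, h3⟩ := ih
    obtain ⟨z, h4, h5, h6⟩ := hnext y
    refine ⟨z, h1.trans h4, h5, ?_⟩
    have : (Finset.Ioo a z).filter P = insert y ((Finset.Ioo a y).filter P) := by
      ext x
      simp only [Finset.mem_filter, Finset.mem_Ioo, Finset.mem_insert]
      constructor
      · rintro ⟨⟨h7, h8⟩, h9⟩
        rcases lt_trichotomy x y with h | h | h
        · exact Or.inr ⟨⟨h7, h⟩, h9⟩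
        · exact Or.inl h
        · exact absurd h9 (h6 x h h8)
      · rintro (rfl | ⟨⟨h7, h8⟩, h9⟩)
        · exact ⟨⟨h1, h4⟩, h2⟩
        · exact ⟨⟨h7, h8.trans h4⟩, h9⟩
    rw [this, Finset.card_insert_of_notMem (by simp), h3]

lemma exists_gt_not_dvd {n N : ℕ} (hN : N < n) (w : ℕ → ℤ) (x : ℤ) :
    ∃ y, x < y ∧ ∀ j < N, ¬ (n : ℤ) ∣ y - w j := by
  have : NeZero n := ⟨by omega⟩
  have hns : ¬ Function.Surjective fun j : Fin N => ((w j : ℤ) : ZMod n) := fun hs => by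
    have := Fintype.card_le_of_surjective _ hs
    rw [ZMod.card, Fintype.card_fin] at this
    omega
  obtain ⟨z, hz⟩ := not_forall.1 hns
  obtain ⟨z, rfl⟩ := ZMod.intCast_surjective z
  refine ⟨z + n * (|x| + |z| + 1), ?_, fun j hj hd => hz ⟨⟨j, hj⟩, ?_⟩⟩
  · have h1 : (1 : ℤ) ≤ n := by exact_mod_cast (by omega : 1 ≤ n)
    have h2 := le_abs_self x
    have h3 := neg_abs_le z
    have h4 := abs_nonneg x
    have h5 := abs_nonneg z
    nlinarith
  · rw [ZMod.intCast_eq_intCast_iff_dvd_sub]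
    have := dvd_sub hd (dvd_mul_right (n : ℤ) (|x| + |z| + 1))
    rwa [show z + n * (|x| + |z| + 1) - w j - n * (|x| + |z| + 1) = z - w j by ring] at this

/-- Greedy construction: after w t, skip exactly m t integers avoiding the classes already used and
take the next one as w (t + 1). -/
lemma exists_isWindow_windowMult_eq (n : ℕ) (m : ℕ → ℕ) :
    ∃ w, IsWindow n w ∧ ∀ t, t + 1 < n → windowMult n w t = m t := by
  suffices H : ∀ N, N ≤ n → ∃ w : ℕ → ℤ, (∀ i j, i < j → j < N → w i < w j) ∧
      (∀ i j, i < N → j < N → (n : ℤ) ∣ w i - w j → i = j) ∧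
      ∀ t, t + 1 < N → windowMult n w t = m t by
    obtain ⟨w, h1, h2, h3⟩ := H n le_rfl
    exact ⟨w, ⟨h1, h2⟩, h3⟩
  intro N
  induction N with
  | zero => exact fun _ => ⟨0, by simp⟩
  | succ N ih =>
    intro hN
    obtain ⟨w, h1, h2, h3⟩ := ih (by omega)
    rcases N with _ | T
    · exact ⟨w, by omega, by omega, by omega⟩
    obtain ⟨y, hy1, hy2, hy3⟩ := exists_card_filter_Ioo_eq
      (fun x => ∀ j ≤ T, ¬ (n : ℤ) ∣ x - w j) (fun x => by
        obtain ⟨y, h4, h5⟩ := exists_gt_not_dvd (show T + 1 < n by omega) w x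
        exact ⟨y, h4, fun j hj => h5 j (by omega)⟩) (w T) (m T)
    have hup : ∀ j, j ≤ T → Function.update w (T + 1) y j = w j := fun j hj =>
      Function.update_of_ne (by omega) _ _
    have hup' : Function.update w (T + 1) y (T + 1) = y := Function.update_self _ _ _
    refine ⟨Function.update w (T + 1) y, ?_, ?_, ?_⟩
    · intro i j hij hj
      rw [hup i (by omega)]
      rcases Nat.lt_or_ge T j with h | h
      · obtain rfl : j = T + 1 := by omega
        rw [hup']
        rcases Nat.lt_or_ge i T with h' | h'
        · exact (h1 i T h' (by omega)).trans hy1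
        · obtain rfl : i = T := by omega
          exact hy1
      · rw [hup j h]
        exact h1 i j hij (by omega)
    · intro i j hi hj hd
      rcases Nat.lt_or_ge T i with h | h <;> rcases Nat.lt_or_ge T j with h' | h'
      · omega
      · obtain rfl : i = T + 1 := by omega
        rw [hup', hup j h'] at hd
        exact absurd hd (hy2 j h')
      · obtain rfl : j = T + 1 := by omega
        rw [hup', hup i h] at hd
        exact absurd (dvd_sub_comm.1 hd) (hy2 i h)
      · rw [hup i h, hup j h'] at hd
        exact h2 i j (by omega) (by omega) hd
    · intro t ht
      rcases Nat.lt_or_ge t T with h | h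
      · rw [← h3 t (by omega)]
        exact windowMult_congr fun j hj => hup j (by omega)
      · obtain rfl : t = T := by omega
        rw [← hy3, windowMult, hup', hup t le_rfl]
        congr 1
        refine Finset.filter_congr fun x _ => forall₂_congr fun j hj => ?_
        rw [hup j hj]

lemma exists_window {k : ℕ} {κ : YoungDiagram} (h : κ.rowLen 0 ≤ k) :
    ∃ w, IsWindow (k + 1) w ∧ HasWindow (k + 1) κ w := by
  obtain ⟨w, hw, hm⟩ := exists_isWindow_windowMult_eq (k + 1) fun t => partMult κ (t + 1)
  exact ⟨w, hw, by omega, fun t ht => (hm t ht).symm⟩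

/-! ### Irreducible partitions and reductions -/

/-- Consecutive terms of the window differ by less than `n`. -/
def IsTight (n : ℕ) (w : ℕ → ℤ) : Prop := ∀ t, t + 1 < n → w (t + 1) - w t < n

/-- The interval from w t to w (t + 1) holds the k - t parts of a rectangle exactly when it spans a
full period. -/
lemma isIrredPartition_iff {k : ℕ} {κ : YoungDiagram} {w : ℕ → ℤ} (hw : IsWindow (k + 1) w)
    (h : HasWindow (k + 1) κ w) : IsIrredPartition k κ ↔ IsTight (k + 1) w := by
  constructor
  · intro hi t ht
    by_contra! hlt
    have h1 := hw.le_windowMult ht hlt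
    have h2 := hi.2 (t + 1) (by omega) (by omega)
    rw [h.partMult_eq t ht] at h2
    omega
  · intro ht
    refine ⟨by have := h.rowLen_lt; omega, fun i h1 h2 => ?_⟩
    obtain ⟨t, rfl⟩ : ∃ t, i = t + 1 := ⟨i - 1, by omega⟩
    have h3 := hw.windowMult_lt (t := t) (by omega) (ht t (by omega))
    rw [h.partMult_eq t (by omega)]
    omega

/-- The window of the reduction of the partition with window `moveWindow w p q`. -/
def reduceWindow (n : ℕ) (w : ℕ → ℤ) (p q : ℕ) (j : ℕ) : ℤ :=
  moveWindow w p q j - if p = q + 1 ∧ p ≤ j then (n : ℤ) else 0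

lemma windowMult_congr_mod {n : ℕ} {w v : ℕ → ℤ} {t : ℕ} {s : ℤ} (h : v t = w t + s)
    (h' : v (t + 1) = w (t + 1) + s) (hd : ∀ j ≤ t, (n : ℤ) ∣ v j - (w j + s)) :
    windowMult n v t = windowMult n w t := by
  rw [← windowMult_add_const n w s, windowMult, windowMult, h, h']
  congr 1
  refine Finset.filter_congr fun x _ => forall₂_congr fun j hj => not_congr ?_
  rw [← dvd_add_left (hd j hj), show x - v j + (v j - (w j + s)) = x - (w j + s) by ring]

namespace IsMove

variable {n : ℕ} {w : ℕ → ℤ} {p q : ℕ}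

lemma isWindow_reduceWindow (h : IsMove n w p q) (hw : IsWindow n w) :
    IsWindow n (reduceWindow n w p q) := by
  have hm := h.isWindow hw
  have hqp := h.lt
  have hpn := h.lt'
  constructor
  · intro i j hij hj
    have h1 := hm.lt i j hij hj
    unfold reduceWindow
    by_cases hc : p = q + 1 ∧ i < p ∧ p ≤ j
    · have h2 := hm.le (show i ≤ q by omega) (by omega)
      have h3 := hm.le hc.2.2 hj
      rw [h.moveWindow_left] at h3
      rw [h.moveWindow_right] at h2
      -- For p = q + 1 the moved entries differ by at least n + 1, so the order survives the
      -- subtraction of n.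
      have h4 : (n : ℤ) ≤ w p + 1 - w q := by
        have := hw.lt q p hqp hpn
        exact Int.le_of_dvd (by omega) h.dvd
      rw [if_neg (by omega : ¬ (p = q + 1 ∧ p ≤ i)), if_pos ⟨hc.1, hc.2.2⟩]
      omega
    · split_ifs <;> omega
  · intro i j hi hj hd
    refine hm.inj i j hi hj ?_
    have h1 : ∀ j, (n : ℤ) ∣ moveWindow w p q j - reduceWindow n w p q j := fun j => by
      rw [reduceWindow, sub_sub_cancel]
      split_ifs <;> simp
    have := dvd_sub (dvd_add hd (h1 i)) (h1 j)
    rwa [show reduceWindow n w p q i - reduceWindow n w p q j +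
      (moveWindow w p q i - reduceWindow n w p q i) -
      (moveWindow w p q j - reduceWindow n w p q j) =
      moveWindow w p q i - moveWindow w p q j by ring] at this

/-- A consecutive difference grows by at most 1, except for p = q + 1, where the growth by 2 is
offset by n. It thus stays at most n, and n itself is excluded by incongruence. -/
lemma isTight_reduceWindow (h : IsMove n w p q) (hw : IsWindow n w) (ht : IsTight n w) :
    IsTight n (reduceWindow n w p q) := by
  intro t htn
  have h1 : reduceWindow n w p q (t + 1) - reduceWindow n w p q t ≠ n := fun h1 => by
    have := (h.isWindow_reduceWindow hw).inj (t + 1) t htn (by omega) (by rw [h1])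
    omega
  have h2 := ht t htn
  have hqp := h.lt
  refine lt_of_le_of_ne ?_ h1
  unfold reduceWindow moveWindow
  split_ifs <;> omega

/-- Lowering the tail by one period changes only the interval where the tail begins, and removes one
rectangle there. -/
lemma windowMult_moveWindow (h : IsMove n w p q) (hw : IsWindow n w) {t : ℕ} (ht : t + 1 < n) :
    windowMult n (moveWindow w p q) t = windowMult n (reduceWindow n w p q) t +
      if p = q + 1 ∧ t = q then n - 1 - t else 0 := by
  have hqp := h.lt
  by_cases hp : p = q + 1
  · rcases lt_trichotomy t q with h1 | h1 | h1
    · rw [if_neg (by omega), add_zero]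
      refine windowMult_congr fun j hj => ?_
      rw [reduceWindow, if_neg (by omega), sub_zero]
    · rw [if_pos ⟨hp, h1⟩]
      refine (h.isWindow_reduceWindow hw).windowMult_add_period ht (fun j hj => ?_) ?_
      · rw [reduceWindow, if_neg (by omega), sub_zero]
      · rw [reduceWindow, if_pos (by omega), sub_add_cancel]
    · rw [if_neg (by omega), add_zero]
      refine windowMult_congr_mod (s := n) ?_ ?_ fun j hj => ?_
      · rw [reduceWindow, if_pos (by omega), sub_add_cancel]
      · rw [reduceWindow, if_pos (by omega), sub_add_cancel]
      · unfold reduceWindow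
        split_ifs <;> simp
  · rw [if_neg (by tauto), add_zero]
    refine windowMult_congr fun j hj => ?_
    rw [reduceWindow, if_neg (by tauto), sub_zero]

variable {k : ℕ} {δ ν : YoungDiagram}

lemma rectExponent_eq (h : IsMove (k + 1) w p q) (hw : IsWindow (k + 1) w)
    (ht : IsTight (k + 1) w) (hδ : HasWindow (k + 1) δ (moveWindow w p q)) {a : ℕ}
    (ha : 1 ≤ a) (hak : a ≤ k) :
    rectExponent k δ a = if p = q + 1 ∧ a = k - q then 1 else 0 := by
  have hqp := h.lt
  have hpk := h.lt'
  have h1 := (h.isWindow_reduceWindow hw).windowMult_lt (t := k - a) (by omega)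
    (h.isTight_reduceWindow hw ht _ (by omega))
  rw [rectExponent, show k + 1 - a = k - a + 1 by omega, hδ.partMult_eq _ (by omega),
    h.windowMult_moveWindow hw (by omega)]
  have h2 : k + 1 - 1 - (k - a) = a := by omega
  rw [h2] at h1 ⊢
  by_cases hc : p = q + 1 ∧ a = k - q
  · rw [if_pos hc, if_pos (by omega), Nat.add_div_right _ (by omega), Nat.div_eq_of_lt h1]
  · rw [if_neg hc, if_neg (by omega), add_zero, Nat.div_eq_of_lt h1]

lemma isReduction_iff (h : IsMove (k + 1) w p q) (hw : IsWindow (k + 1) w)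
    (ht : IsTight (k + 1) w) (hδ : HasWindow (k + 1) δ (moveWindow w p q)) :
    IsReduction k δ ν ↔ HasWindow (k + 1) ν (reduceWindow (k + 1) w p q) := by
  have hqp := h.lt
  have hpk := h.lt'
  have key : ∀ t, t < k → partMult δ (t + 1) = windowMult (k + 1) (reduceWindow (k + 1) w p q) t +
      rectExponent k δ (k - t) * (k - t) := fun t htk => by
    rw [hδ.partMult_eq t (by omega), h.windowMult_moveWindow hw (by omega),
      h.rectExponent_eq hw ht hδ (by omega) (by omega)]
    by_cases hc : p = q + 1 ∧ t = q
    · rw [if_pos hc, if_pos (by omega), one_mul]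
      omega
    · rw [if_neg hc, if_neg (by omega), zero_mul]
  constructor
  · rintro ⟨h1, h2⟩
    refine ⟨by have := h1.1; omega, fun t htk => ?_⟩
    have h3 := h2 (k - t) (by omega) (by omega)
    rw [show k + 1 - (k - t) = t + 1 by omega, key t (by omega)] at h3
    omega
  · intro hν
    refine ⟨(isIrredPartition_iff (h.isWindow_reduceWindow hw) hν).2
      (h.isTight_reduceWindow hw ht), fun a h1 h2 => ?_⟩
    have h3 := key (k - a) (by omega)
    rw [show k - (k - a) = a by omega] at h3
    rw [show k + 1 - a = k - a + 1 by omega, h3, hν.partMult_eq _ (by omega)]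

lemma prod_rectExponent (h : IsMove (k + 1) w p q) (hw : IsWindow (k + 1) w)
    (ht : IsTight (k + 1) w) (hδ : HasWindow (k + 1) δ (moveWindow w p q)) (r : ℕ → ℝ) :
    ∏ a ∈ Finset.Icc 1 k, r a ^ rectExponent k δ a = if p = q + 1 then r (k - q) else 1 := by
  have hqp := h.lt
  have hpk := h.lt'
  have h1 : ∀ a ∈ Finset.Icc 1 k, r a ^ rectExponent k δ a =
      if p = q + 1 ∧ a = k - q then r a else 1 := fun a ha => by
    rw [Finset.mem_Icc] at ha
    rw [h.rectExponent_eq hw ht hδ ha.1 ha.2]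
    split_ifs <;> simp
  rw [Finset.prod_congr rfl h1]
  by_cases hp : p = q + 1
  · have hmem : k - q ∈ Finset.Icc 1 k := Finset.mem_Icc.2 (by omega)
    simp [hp, Finset.prod_ite_eq', hmem]
  · simp [hp]

end IsMove

/-! ### Positivity of the matrix entries -/

lemma phiEntry_nonneg {k : ℕ} {r : ℕ → ℝ} (hr : ∀ a, 1 ≤ a → a ≤ k → 0 ≤ r a)
    (κ ν : YoungDiagram) : 0 ≤ phiEntry k r κ ν :=
  finsum_nonneg fun _ => finsum_nonneg fun _ => Finset.prod_nonneg fun a ha =>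
    pow_nonneg (hr a (Finset.mem_Icc.1 ha).1 (Finset.mem_Icc.1 ha).2) _

lemma phiEntry_pos_iff {k : ℕ} (hk : 1 ≤ k) {r : ℕ → ℝ} (hr : ∀ a, 1 ≤ a → a ≤ k → 0 ≤ r a)
    {w : ℕ → ℤ} (hw : IsWindow (k + 1) w) (ht : IsTight (k + 1) w) {κ ν : YoungDiagram}
    (hκ : HasWindow (k + 1) κ w) :
    0 < phiEntry k r κ ν ↔ ∃ p q, IsMove (k + 1) w p q ∧
      HasWindow (k + 1) ν (reduceWindow (k + 1) w p q) ∧ (p = q + 1 → 0 < r (k - q)) := by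
  -- A successor is determined by its pair (p, q). Finiteness matters because `finsum` over an
  -- infinite support would be 0.
  have hfin : {μ | BoundedArrow k κ μ ∧ IsReduction k μ ν}.Finite := by
    choose! p q hm hδ using fun μ => (boundedArrow_iff (δ := μ) hk hw hκ).1
    refine Set.Finite.of_finite_image
      (f := fun μ => (p μ, q μ)) ((Finset.range (k + 1) ×ˢ Finset.range (k + 1)).finite_toSet.subset
      ?_) ?_
    · rintro _ ⟨μ, hμ, rfl⟩
      have h1 := (hm μ hμ.1).lt
      have h2 := (hm μ hμ.1).lt'
      simp only [Finset.coe_product, Finset.coe_range, Set.mem_prod, Set.mem_Iio]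
      omega
    · intro μ hμ μ' hμ' heq
      rw [Prod.mk.injEq] at heq
      have h1 := hδ μ hμ.1
      rw [heq.1, heq.2] at h1
      exact h1.unique (hδ μ' hμ'.1)
  have hsum : phiEntry k r κ ν =
      ∑ μ ∈ hfin.toFinset, ∏ a ∈ Finset.Icc 1 k, r a ^ rectExponent k μ a :=
    finsum_mem_eq_finite_toFinset_sum _ hfin
  rw [hsum, Finset.sum_pos_iff_of_nonneg fun μ _ => Finset.prod_nonneg fun a ha =>
    pow_nonneg (hr a (Finset.mem_Icc.1 ha).1 (Finset.mem_Icc.1 ha).2) _]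
  simp only [Set.Finite.mem_toFinset, Set.mem_ofPred_eq]
  constructor
  · rintro ⟨μ, ⟨h1, h2⟩, h3⟩
    obtain ⟨p, q, hm, hδ⟩ := (boundedArrow_iff hk hw hκ).1 h1
    refine ⟨p, q, hm, (hm.isReduction_iff hw ht hδ).1 h2, fun hp => ?_⟩
    rwa [hm.prod_rectExponent hw ht hδ, if_pos hp] at h3
  · rintro ⟨p, q, hm, hν, hpos⟩
    obtain ⟨δ, hδ⟩ := (hm.isWindow hw).exists_hasWindow
    refine ⟨δ, ⟨(boundedArrow_iff hk hw hκ).2 ⟨p, q, hm, hδ⟩,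
      (hm.isReduction_iff hw ht hδ).2 hν⟩, ?_⟩
    rw [hm.prod_rectExponent hw ht hδ]
    split_ifs with hp
    · exact hpos hp
    · exact one_pos

/-! ### An absorbing class when two consecutive weights vanish -/

/-- The window of `κ` is tight and satisfies `w (c + 2) - w c > n`: the residues of
`w c`, `w (c + 2)`, `w (c + 1)` follow each other in this cyclic order. -/
def IsTwisted (k c : ℕ) (κ : YoungDiagram) : Prop :=
  ∃ w, IsWindow (k + 1) w ∧ IsTight (k + 1) w ∧ HasWindow (k + 1) κ w ∧
    ((k + 1 : ℕ) : ℤ) < w (c + 2) - w c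

lemma IsTwisted.of_phiEntry_pos {k c : ℕ} (hc : c + 2 ≤ k) {r : ℕ → ℝ}
    (hr : ∀ a, 1 ≤ a → a ≤ k → 0 ≤ r a) (h0 : r (k - c) = 0) (h1 : r (k - (c + 1)) = 0)
    {κ ν : YoungDiagram} (hκ : IsTwisted k c κ) (hpos : 0 < phiEntry k r κ ν) :
    IsTwisted k c ν := by
  obtain ⟨w, hw, ht, hκw, hlt⟩ := hκ
  obtain ⟨p, q, hm, hν, hp⟩ := (phiEntry_pos_iff (by omega) hr hw ht hκw).1 hpos
  have hw' := hm.isWindow_reduceWindow hw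
  refine ⟨_, hw', hm.isTight_reduceWindow hw ht, hν, ?_⟩
  have hq0 : p = q + 1 → q ≠ c := fun h e => by
    have := hp h
    rw [e, h0] at this
    exact lt_irrefl _ this
  have hq1 : p = q + 1 → q ≠ c + 1 := fun h e => by
    have := hp h
    rw [e, h1] at this
    exact lt_irrefl _ this
  have hne : reduceWindow (k + 1) w p q (c + 2) - reduceWindow (k + 1) w p q c ≠
      ((k + 1 : ℕ) : ℤ) := fun h => by
    have := hw'.inj (c + 2) c (by omega) (by omega) (by rw [h])
    omega
  -- Since p is neither c + 1 with q = c nor c + 2 with q = c + 1, the subtraction of n affects both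
  -- entries or neither. The difference drops by at most 1, as p = c and q = c + 2 cannot hold
  -- together, and it cannot become n.
  refine lt_of_le_of_ne ?_ hne.symm
  have hqp := hm.lt
  unfold reduceWindow moveWindow
  split_ifs <;> omega

lemma exists_isTwisted {k c : ℕ} (hc : c + 2 ≤ k) :
    ∃ κ, IsIrredPartition k κ ∧ IsTwisted k c κ := by
  -- The residues of the identity with c + 1 and c + 2 exchanged; adding n from c + 2 on restores
  -- the increasing order.
  set v : ℕ → ℤ := fun j => if j = c + 1 then c + 2 else if j = c + 2 then c + 1 else j with hv
  set w : ℕ → ℤ := fun j => v j + if c + 2 ≤ j then ((k + 1 : ℕ) : ℤ) else 0 with hwdef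
  have hw : IsWindow (k + 1) w := by
    constructor
    · intro i j hij hj
      simp only [hwdef, hv]
      split_ifs <;> omega
    · intro i j hi hj hd
      have h1 : ((k + 1 : ℕ) : ℤ) ∣ v i - v j := by
        have h2 : ∀ j, ((k + 1 : ℕ) : ℤ) ∣ w j - v j := fun j => by
          simp only [hwdef]
          split_ifs <;> simp
        have := dvd_add (dvd_sub hd (h2 i)) (h2 j)
        rwa [show w i - w j - (w i - v i) + (w j - v j) = v i - v j by ring] at this
      have h2 : ∀ j, j < k + 1 → 0 ≤ v j ∧ v j < ((k + 1 : ℕ) : ℤ) := fun j hj => by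
        simp only [hv]
        split_ifs <;> omega
      have h3 := h2 i hi
      have h4 := h2 j hj
      have h5 := eq_of_dvd_of_abs_lt h1 (by omega) (by omega)
      simp only [hv] at h5
      split_ifs at h5 <;> omega
  have ht : IsTight (k + 1) w := by
    intro t htk
    simp only [hwdef, hv]
    split_ifs <;> omega
  obtain ⟨κ, hκ⟩ := hw.exists_hasWindow
  refine ⟨κ, (isIrredPartition_iff hw hκ).2 ht, w, hw, ht, hκ, ?_⟩
  simp only [hwdef, hv]
  split_ifs <;> omega

lemma exists_not_isTwisted {k c : ℕ} (hc : c + 2 ≤ k) :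
    ∃ κ, IsIrredPartition k κ ∧ ¬ IsTwisted k c κ := by
  have hw : IsWindow (k + 1) fun j => (j : ℤ) :=
    ⟨fun i j hij _ => by exact_mod_cast hij, fun i j hi hj hd => by
      exact_mod_cast eq_of_dvd_of_abs_lt hd (by omega) (by omega)⟩
  have ht : IsTight (k + 1) fun j => (j : ℤ) := fun t htk => by
    push_cast
    omega
  obtain ⟨κ, hκ⟩ := hw.exists_hasWindow
  refine ⟨κ, (isIrredPartition_iff hw hκ).2 ht, ?_⟩
  rintro ⟨v, hv, -, hκ', hlt⟩
  have hs := hw.eq_add_const hv fun t htk => by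
    rw [← hκ.partMult_eq t htk, ← hκ'.partMult_eq t htk]
  rw [hs (c + 2) (by omega), hs c (by omega)] at hlt
  push_cast at hlt
  omega

/-! ### Cyclic words -/

/-- Moves on cyclic words: rotation, and exchange of adjacent letters `p > q` into increasing
order, where the exchange of `q + 1` and `q` is allowed only if `t q` holds. -/
inductive CyclicStep (t : ℕ → Prop) : List ℕ → List ℕ → Prop
  | swap (a : List ℕ) (p q : ℕ) (b : List ℕ) (h : q < p) (ht : p = q + 1 → t q) :
      CyclicStep t (a ++ p :: q :: b) (a ++ q :: p :: b)
  | rotate (x : ℕ) (a : List ℕ) : CyclicStep t (x :: a) (a ++ [x])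

namespace CyclicStep

variable {t : ℕ → Prop}

lemma perm {l l' : List ℕ} (h : CyclicStep t l l') : l.Perm l' := by
  cases h with
  | swap a p q b => exact (List.Perm.swap q p b).append_left a
  | rotate x a => exact (List.perm_append_singleton x a).symm

lemma reach_append_comm (a b : List ℕ) : ReflTransGen (CyclicStep t) (a ++ b) (b ++ a) := by
  induction a generalizing b with
  | nil => simpa using ReflTransGen.refl
  | cons x a ih =>
    have h1 : CyclicStep t (x :: a ++ b) (a ++ (b ++ [x])) := by
      simpa using rotate (t := t) x (a ++ b)
    have h2 := ih (b ++ [x])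
    rw [List.append_assoc] at h2
    exact ReflTransGen.head h1 h2

/-- The letter `m` may jump over the letter `x`. -/
def CanPass (t : ℕ → Prop) (m x : ℕ) : Prop := x < m ∧ (m = x + 1 → t x)

lemma reach_pass {m : ℕ} (a b c : List ℕ) (h : ∀ x ∈ b, CanPass t m x) :
    ReflTransGen (CyclicStep t) (a ++ m :: (b ++ c)) (a ++ (b ++ m :: c)) := by
  induction b generalizing a with
  | nil => exact ReflTransGen.refl
  | cons x b ih =>
    have hx := h x (by simp)
    have h1 : CyclicStep t (a ++ m :: (x :: b ++ c)) ((a ++ [x]) ++ m :: (b ++ c)) := by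
      simpa using swap a m x (b ++ c) hx.1 hx.2
    have h2 := ih (a ++ [x]) fun y hy => h y (by simp [hy])
    rw [show a ++ [x] ++ (b ++ m :: c) = a ++ (x :: b ++ m :: c) by simp] at h2
    exact ReflTransGen.head h1 h2

/-- A block of letters that can pass all the letters of a cyclic word does not obstruct its
moves. -/
lemma reach_append_left {d : List ℕ} {u v : List ℕ} (h : ReflTransGen (CyclicStep t) u v)
    (hd : ∀ m ∈ d, ∀ x ∈ u, CanPass t m x) :
    ReflTransGen (CyclicStep t) (d ++ u) (d ++ v) := by
  have key : ∀ (d : List ℕ) (x : ℕ) (c : List ℕ), (∀ m ∈ d, CanPass t m x) →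
      ReflTransGen (CyclicStep t) (d ++ x :: c) (x :: (d ++ c)) := by
    intro d
    induction d using List.reverseRecOn with
    | nil => exact fun x c _ => ReflTransGen.refl
    | append_singleton d m ih =>
      intro x c hm
      have h1 := reach_pass (t := t) d [x] c (m := m) (by simpa using hm m (by simp))
      have h2 := ih x (m :: c) fun y hy => hm y (by simp [hy])
      simpa using h1.trans h2
  induction h with
  | refl => exact ReflTransGen.refl
  | @tail v w huv hvw ih =>
    have hperm : u.Perm v := by
      clear ih hvw
      induction huv with
      | refl => exact List.Perm.refl _
      | tail _ h ih => exact ih.trans h.perm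
    refine ih.trans ?_
    cases hvw with
    | swap a p q b hqp ht =>
      rw [← List.append_assoc, ← List.append_assoc]
      exact ReflTransGen.single (swap (d ++ a) p q b hqp ht)
    | rotate x a =>
      have h1 := key d x a fun m hm => hd m hm x (hperm.symm.subset (by simp))
      refine h1.trans (ReflTransGen.single ?_)
      simpa using rotate (t := t) x (d ++ a)

lemma exists_perm_range {m : ℕ} {l : List ℕ} (h : l.Perm (List.range (m + 1))) :
    ∃ a b, l = a ++ m :: b ∧ (b ++ a).Perm (List.range m) ∧ (a ++ b).Perm (List.range m) := by
  obtain ⟨a, b, rfl⟩ := List.append_of_mem (h.symm.subset (by simp : m ∈ List.range (m + 1)))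
  rw [List.range_succ] at h
  have h1 : (a ++ b).Perm (List.range m) := by
    have := (List.perm_middle.symm.trans h).trans (List.perm_append_singleton m _)
    exact this.cons_inv
  exact ⟨a, b, rfl, List.perm_append_comm.trans h1, h1⟩

/-- If no two consecutive exchanges are forbidden, any two cyclic words are connected. -/
lemma reach_of_perm_range {n : ℕ} (ht : ∀ q, q + 2 < n → t q ∨ t (q + 1)) {l l' : List ℕ}
    (hl : l.Perm (List.range n)) (hl' : l'.Perm (List.range n)) :
    ReflTransGen (CyclicStep t) l l' := by
  induction n using Nat.strong_induction_on generalizing l l' with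
  | _ n ih =>
    rcases n with _ | _ | m
    · rw [List.range_zero, List.perm_nil] at hl hl'
      rw [hl, hl']
    · rw [zero_add, List.range_one, List.perm_singleton] at hl hl'
      rw [hl, hl']
    · obtain ⟨a, b, rfl, hba, -⟩ := exists_perm_range hl
      obtain ⟨a', b', rfl, hba', -⟩ := exists_perm_range hl'
      have hmem : ∀ {u : List ℕ} {N : ℕ}, u.Perm (List.range N) → ∀ x ∈ u, x < N :=
        fun hu x hx => List.mem_range.1 (hu.subset hx)
      have h1 := reach_append_comm (t := t) a ((m + 1) :: b)
      have h2 := reach_append_comm (t := t) ((m + 1) :: b') a'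
      refine h1.trans (ReflTransGen.trans ?_ h2)
      rw [List.cons_append, List.cons_append]
      -- If m + 1 may pass m, it passes every letter and can be set aside.
      by_cases htm : t m
      · have h3 := ih (m + 1) (by omega) (fun q hq => ht q (by omega)) hba hba'
        refine reach_append_left (d := [m + 1]) h3 ?_
        intro p hp x hx
        rw [List.mem_singleton] at hp
        subst hp
        refine ⟨hmem hba x hx, fun h => ?_⟩
        obtain rfl : m = x := by omega
        exact htm
      -- Otherwise m + 1 still passes all letters below m, and m passes them too, since t (m - 1)
      -- must hold when m > 0. So m + 1 is brought next to m, the block m + 1, m is set aside, and m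
      -- is finally moved to its target place.
      · obtain ⟨c, d, hcd, hdc, hcd'⟩ := exists_perm_range hba
        obtain ⟨e, f, hef, -, hef'⟩ := exists_perm_range hba'
        have hp1 : ∀ x < m, CanPass t (m + 1) x := fun x hx => ⟨by omega, by omega⟩
        have hp2 : ∀ x < m, CanPass t m x := fun x hx => ⟨hx, fun h => by
          subst h
          exact (ht x (by omega)).resolve_right htm⟩
        rw [hcd, hef]
        have h3 := reach_pass (t := t) [] c (m :: d) (m := m + 1)
          fun x hx => hp1 x (hmem hcd' x (by simp [hx]))
        have h4 := reach_append_comm (t := t) c ((m + 1) :: m :: d)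
        have h5 := ih m (by omega) (fun q hq => ht q (by omega)) hdc hef'
        have h6 := reach_append_left (d := [m + 1, m]) h5 (by
          intro p hp x hx
          have := hmem hdc x hx
          simp only [List.mem_cons, List.not_mem_nil, or_false] at hp
          rcases hp with rfl | rfl
          · exact hp1 x this
          · exact hp2 x this)
        have h7 := reach_pass (t := t) [m + 1] e f (m := m)
          fun x hx => hp2 x (hmem hef' x (by simp [hx]))
        exact ((h3.trans h4).trans h6).trans h7

end CyclicStep

/-! ### Irreducible partitions as cyclic words -/

/-- The letters of `l` list, up to rotation, the window indices of `κ` in the order of the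
residues of the window. -/
def HasWord (k : ℕ) (κ : YoungDiagram) (l : List ℕ) : Prop :=
  ∃ (w : ℕ → ℤ) (s : ℤ), IsWindow (k + 1) w ∧ IsTight (k + 1) w ∧ HasWindow (k + 1) κ w ∧
    ∀ j < k + 1, ((k + 1 : ℕ) : ℤ) ∣ w j - l.idxOf j - s

lemma HasWord.isIrredPartition {k : ℕ} {κ : YoungDiagram} {l : List ℕ} (h : HasWord k κ l) :
    IsIrredPartition k κ := by
  obtain ⟨w, s, hw, ht, hκ, -⟩ := h
  exact (isIrredPartition_iff hw hκ).2 ht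

lemma IsIrredPartition.exists_hasWord {k : ℕ} {κ : YoungDiagram} (h : IsIrredPartition k κ) :
    ∃ l : List ℕ, l.Perm (List.range (k + 1)) ∧ HasWord k κ l := by
  obtain ⟨w, hw, hκ⟩ := exists_window h.1
  choose idx h1 h2 using fun i : ℕ => hw.exists_index (Nat.succ_pos k) (i : ℤ)
  have hinj : ∀ i ∈ List.range (k + 1), ∀ j ∈ List.range (k + 1), idx i = idx j → i = j := by
    intro i hi j hj hij
    rw [List.mem_range] at hi hj
    have h3 := dvd_sub (h2 i) (h2 j)
    rw [hij, sub_sub_sub_cancel_right] at h3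
    exact_mod_cast eq_of_dvd_of_abs_lt h3 (by omega) (by omega)
  have hnd : ((List.range (k + 1)).map idx).Nodup :=
    List.Nodup.map_on hinj List.nodup_range
  have hperm : ((List.range (k + 1)).map idx).Perm (List.range (k + 1)) := by
    refine (hnd.subperm fun x hx => ?_).perm_of_length_le (by simp)
    obtain ⟨i, -, rfl⟩ := List.mem_map.1 hx
    exact List.mem_range.2 (h1 i)
  refine ⟨_, hperm, w, 0, hw, (isIrredPartition_iff hw hκ).1 h, hκ, fun j hj => ?_⟩
  have hlt := List.idxOf_lt_length_iff.2 (hperm.symm.subset (List.mem_range.2 hj))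
  have hget := List.getElem_idxOf hlt
  rw [List.getElem_map, List.getElem_range] at hget
  have h3 := h2 (((List.range (k + 1)).map idx).idxOf j)
  rw [hget] at h3
  rw [sub_zero]
  exact dvd_sub_comm.1 h3

/-- The word fixes consecutive differences modulo k + 1, and tightness puts them strictly between 0
and k + 1. -/
lemma HasWord.unique {k : ℕ} {κ κ' : YoungDiagram} {l : List ℕ} (h : HasWord k κ l)
    (h' : HasWord k κ' l) : κ = κ' := by
  obtain ⟨w, s, hw, ht, hκ, hl⟩ := h
  obtain ⟨v, s', hv, ht', hκ', hl'⟩ := h'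
  have hs : ∀ j < k + 1, v j = w j + (v 0 - w 0) := by
    intro j
    induction j with
    | zero => intro _; ring
    | succ j ih =>
      intro hj
      have h1 := ih (by omega)
      have h2 := dvd_sub (dvd_sub (hl _ hj) (hl' _ hj))
        (dvd_sub (hl j (by omega)) (hl' j (by omega)))
      rw [show w (j + 1) - l.idxOf (j + 1) - s - (v (j + 1) - l.idxOf (j + 1) - s') -
        (w j - l.idxOf j - s - (v j - l.idxOf j - s')) =
        (w (j + 1) - w j) - (v (j + 1) - v j) by ring] at h2
      have h3 := ht j hj
      have h4 := ht' j hj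
      have h5 := hw.lt j (j + 1) (by omega) hj
      have h6 := hv.lt j (j + 1) (by omega) hj
      have h7 := eq_of_dvd_of_abs_lt h2 (by omega) (by omega)
      omega
  exact (hκ.congr hs).unique hκ'

lemma idxOf_swap {a b : List ℕ} {p q : ℕ} (h : (a ++ p :: q :: b).Nodup) (j : ℕ) :
    (a ++ q :: p :: b).idxOf j = (a ++ p :: q :: b).idxOf (Equiv.swap p q j) := by
  rw [List.nodup_append] at h
  obtain ⟨-, h1, h2⟩ := h
  have hpq : p ≠ q := fun h => by simp [h] at h1
  have hp : p ∉ a := fun h => h2 p h p (by simp) rfl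
  have hq : q ∉ a := fun h => h2 q h q (by simp) rfl
  by_cases hjp : j = p
  · subst hjp
    rw [Equiv.swap_apply_left, List.idxOf_append_of_notMem hp, List.idxOf_append_of_notMem hq,
      List.idxOf_cons_ne _ hpq.symm, List.idxOf_cons_self, List.idxOf_cons_ne _ hpq,
      List.idxOf_cons_self]
  · by_cases hjq : j = q
    · subst hjq
      rw [Equiv.swap_apply_right, List.idxOf_append_of_notMem hp, List.idxOf_append_of_notMem hq,
        List.idxOf_cons_self, List.idxOf_cons_self]
    · rw [Equiv.swap_apply_of_ne_of_ne hjp hjq]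
      by_cases hja : j ∈ a
      · rw [List.idxOf_append_of_mem hja, List.idxOf_append_of_mem hja]
      · rw [List.idxOf_append_of_notMem hja, List.idxOf_append_of_notMem hja,
          List.idxOf_cons_ne _ (Ne.symm hjq), List.idxOf_cons_ne _ (Ne.symm hjp),
          List.idxOf_cons_ne _ (Ne.symm hjp), List.idxOf_cons_ne _ (Ne.symm hjq)]

lemma HasWord.step {k : ℕ} (hk : 1 ≤ k) {r : ℕ → ℝ} (hr : ∀ a, 1 ≤ a → a ≤ k → 0 ≤ r a)
    {κ : YoungDiagram} {l l' : List ℕ} (h : HasWord k κ l) (hl : l.Perm (List.range (k + 1)))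
    (hs : CyclicStep (fun q => 0 < r (k - q)) l l') :
    ∃ ν, HasWord k ν l' ∧ (ν = κ ∨ 0 < phiEntry k r κ ν) := by
  have hnd : l.Nodup := hl.nodup_iff.2 List.nodup_range
  have hlen : l.length = k + 1 := by rw [hl.length_eq, List.length_range]
  obtain ⟨w, s, hw, ht, hκ, hidx⟩ := h
  cases hs with
  | swap a p q b hqp hpq =>
    have hpk : p < k + 1 := List.mem_range.1 (hl.subset (by simp))
    have hm : IsMove (k + 1) w p q := by
      refine ⟨hqp, hpk, ?_⟩
      have h1 := hidx p hpk
      have h2 := hidx q (hqp.trans hpk)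
      have h3 := hnd
      rw [List.nodup_append] at h3
      have hp : p ∉ a := fun h => h3.2.2 p h p (by simp) rfl
      have hq : q ∉ a := fun h => h3.2.2 q h q (by simp) rfl
      rw [List.idxOf_append_of_notMem hp, List.idxOf_cons_self] at h1
      rw [List.idxOf_append_of_notMem hq, List.idxOf_cons_ne _ hqp.ne', List.idxOf_cons_self] at h2
      have h4 := dvd_sub h1 h2
      push_cast at h4 ⊢
      rwa [show w p - ((a.length : ℤ) + 0) - s - (w q - ((a.length : ℤ) + 1) - s) =
        w p + 1 - w q by ring] at h4
    have hw' := hm.isWindow_reduceWindow hw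
    obtain ⟨ν, hν⟩ := hw'.exists_hasWindow
    refine ⟨ν, ⟨_, s, hw', hm.isTight_reduceWindow hw ht, hν, fun j hj => ?_⟩,
      Or.inr ((phiEntry_pos_iff hk hr hw ht hκ).2 ⟨p, q, hm, hν, hpq⟩)⟩
    rw [idxOf_swap hnd]
    have h1 := hidx _ (hm.swap_lt hj)
    have h2 := hm.dvd_moveWindow_sub j
    have h3 : ((k + 1 : ℕ) : ℤ) ∣ reduceWindow (k + 1) w p q j - moveWindow w p q j := by
      rw [reduceWindow, sub_sub_cancel_left, dvd_neg]
      split_ifs <;> simp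
    have h4 := dvd_add (dvd_add h1 h2) h3
    generalize (a ++ p :: q :: b).idxOf (Equiv.swap p q j) = i at h4 ⊢
    rwa [show w (Equiv.swap p q j) - i - s + (moveWindow w p q j - w (Equiv.swap p q j)) +
      (reduceWindow (k + 1) w p q j - moveWindow w p q j) =
      reduceWindow (k + 1) w p q j - i - s by ring] at h4
  | rotate x a =>
    -- Rotation lowers all positions by one modulo k + 1 (0 becomes k); the shift s + 1 compensates
    -- and the window is unchanged.
    refine ⟨κ, ⟨w, s + 1, hw, ht, hκ, fun j hj => ?_⟩, Or.inl rfl⟩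
    have h1 := hidx j hj
    have hxa : x ∉ a := (List.nodup_cons.1 hnd).1
    by_cases hjx : j = x
    · subst hjx
      rw [List.idxOf_cons_self] at h1
      rw [List.idxOf_append_of_notMem hxa, List.idxOf_cons_self]
      have h2 := dvd_sub h1 (dvd_refl ((k + 1 : ℕ) : ℤ))
      rw [List.length_cons] at hlen
      have h3 : (a.length : ℤ) = k := by omega
      push_cast at h2 ⊢
      rw [h3]
      rwa [show w j - 0 - s - ((k : ℤ) + 1) = w j - ((k : ℤ) + 0) - (s + 1) by ring] at h2
    · have hja : j ∈ a := by
        have := hl.symm.subset (List.mem_range.2 hj)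
        exact (List.mem_cons.1 this).resolve_left hjx
      rw [List.idxOf_cons_ne _ (Ne.symm hjx)] at h1
      rw [List.idxOf_append_of_mem hja]
      push_cast at h1 ⊢
      rwa [show w j - ((a.idxOf j : ℤ) + 1) - s = w j - (a.idxOf j : ℤ) - (s + 1) by ring] at h1

lemma HasWord.reach {k : ℕ} (hk : 1 ≤ k) {r : ℕ → ℝ} (hr : ∀ a, 1 ≤ a → a ≤ k → 0 ≤ r a)
    {κ : IrredPartition k} {l l' : List ℕ} (h : HasWord k κ.1 l)
    (hl : l.Perm (List.range (k + 1)))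
    (hs : ReflTransGen (CyclicStep fun q => 0 < r (k - q)) l l') :
    ∃ ν : IrredPartition k, HasWord k ν.1 l' ∧ l'.Perm (List.range (k + 1)) ∧
      ReflTransGen (fun κ ν : IrredPartition k => 0 < phiEntry k r κ.1 ν.1) κ ν := by
  induction hs with
  | refl => exact ⟨κ, h, hl, ReflTransGen.refl⟩
  | tail _ hstep ih =>
    obtain ⟨ν, hν, hperm, hreach⟩ := ih
    obtain ⟨ρ, hρ, hor⟩ := hν.step hk hr hperm hstep
    refine ⟨⟨ρ, hρ.isIrredPartition⟩, hρ, hstep.perm.symm.trans hperm, ?_⟩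
    rcases hor with rfl | hpos
    · exact hreach
    · exact hreach.tail hpos

/-! ### Irreducibility of the matrix -/

/-- The matrix with entry `φ_{λν}` at `(λ, ν)` is irreducible iff no two consecutive weights
vanish. -/
lemma isIrreducible_phiMatrix_transpose_iff {k : ℕ} (hk : 2 ≤ k) {r : ℕ → ℝ}
    (hr : ∀ a, 1 ≤ a → a ≤ k → 0 ≤ r a) :
    (phiMatrix k r).transpose.IsIrreducible ↔
      ∀ a, 1 ≤ a → a ≤ k - 1 → 0 < r a ∨ 0 < r (a + 1) := by
  have hentry : ∀ κ ν, (phiMatrix k r).transpose κ ν = phiEntry k r κ.1 ν.1 := fun _ _ => rfl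
  constructor
  · intro h a ha hak
    by_contra! hneg
    obtain ⟨c, hc⟩ : ∃ c, c = k - 1 - a := ⟨_, rfl⟩
    have hck : c + 2 ≤ k := by omega
    have h0 : r (k - c) = 0 := by
      rw [show k - c = a + 1 by omega]
      exact le_antisymm hneg.2 (hr _ (by omega) (by omega))
    have h1 : r (k - (c + 1)) = 0 := by
      rw [show k - (c + 1) = a by omega]
      exact le_antisymm hneg.1 (hr _ ha (by omega))
    obtain ⟨κ, hκi, hκ⟩ := exists_isTwisted hck
    obtain ⟨ν, hνi, hν⟩ := exists_not_isTwisted hck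
    let : Quiver (IrredPartition k) := (phiMatrix k r).transpose.toQuiver
    obtain ⟨path, -⟩ := h.connected ⟨κ, hκi⟩ ⟨ν, hνi⟩
    have key : ∀ {i j : IrredPartition k}, Quiver.Path i j →
        IsTwisted k c i.1 → IsTwisted k c j.1 := by
      intro i j path hi
      induction path with
      | nil => exact hi
      | cons _ e ih => exact ih.of_phiEntry_pos hck hr h0 h1 e.down
    exact hν (key path hκ)
  · intro hcond
    refine ⟨fun κ ν => phiEntry_nonneg hr _ _, ?_⟩
    have hreach : ∀ κ ν : IrredPartition k,
        ReflTransGen (fun κ ν : IrredPartition k => 0 < phiEntry k r κ.1 ν.1) κ ν := by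
      intro κ ν
      obtain ⟨l, hl, hκ⟩ := κ.2.exists_hasWord
      obtain ⟨l', hl', hν⟩ := ν.2.exists_hasWord
      obtain ⟨ρ, hρ, -, hκρ⟩ := hκ.reach (by omega) hr hl
        (CyclicStep.reach_of_perm_range (fun q hq => by
          have := hcond (k - (q + 1)) (by omega) (by omega)
          rw [show k - (q + 1) + 1 = k - q by omega] at this
          exact this.symm) hl hl')
      rwa [Subtype.ext (hρ.unique hν)] at hκρ
    let : Quiver (IrredPartition k) := (phiMatrix k r).transpose.toQuiver
    have hconn : Quiver.IsStronglyConnected (IrredPartition k) := by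
      intro κ ν
      induction hreach κ ν with
      | refl => exact ⟨Quiver.Path.nil⟩
      | tail _ e ih => exact ih.map fun path => path.cons ⟨e⟩
    -- Irreducibility requires paths of positive length, so one arrow must be exhibited; two
    -- distinct vertices, which exist because k ≥ 2, provide it.
    obtain ⟨κ, hκi, hκ⟩ := exists_isTwisted (c := 0) hk
    obtain ⟨ν, hνi, hν⟩ := exists_not_isTwisted (c := 0) hk
    rcases (hreach ⟨κ, hκi⟩ ⟨ν, hνi⟩).cases_head with heq | ⟨ρ, e, -⟩
    · rw [Subtype.mk.injEq] at heq
      exact absurd (heq ▸ hκ) hν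
    · exact hconn.isSStronglyConnected_of_hom (i₀ := ⟨κ, hκi⟩) (j₀ := ρ) ⟨e⟩

theorem mainTheorem5 (k : ℕ) (hk : 2 ≤ k) :
    (∀ φ : LambdaK k →ₐ[ℝ] ℝ,
      (∀ a, 1 ≤ a → a ≤ k → 0 ≤ φ (rectSchur k a)) →
        ((phiMatrix k fun a => φ (rectSchur k a)).IsIrreducible ↔
          ∀ a, 1 ≤ a → a ≤ k - 1 → 0 < φ (rectSchur k a) ∨ 0 < φ (rectSchur k (a + 1))) ∧
        ((phiMatrix k fun a => φ (rectSchur k a)).transpose.IsIrreducible ↔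
          ∀ a, 1 ≤ a → a ≤ k - 1 → 0 < φ (rectSchur k a) ∨ 0 < φ (rectSchur k (a + 1)))) ∧
    (∀ r : ℕ → ℝ,
      (∀ a, 1 ≤ a → a ≤ k → 0 ≤ r a) →
        ((phiMatrix k r).IsIrreducible ↔
          ∀ a, 1 ≤ a → a ≤ k - 1 → 0 < r a ∨ 0 < r (a + 1)) ∧
        ((phiMatrix k r).transpose.IsIrreducible ↔
          ∀ a, 1 ≤ a → a ≤ k - 1 → 0 < r a ∨ 0 < r (a + 1))) := by
  have key : ∀ r : ℕ → ℝ, (∀ a, 1 ≤ a → a ≤ k → 0 ≤ r a) →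
      ((phiMatrix k r).IsIrreducible ↔
        ∀ a, 1 ≤ a → a ≤ k - 1 → 0 < r a ∨ 0 < r (a + 1)) ∧
      ((phiMatrix k r).transpose.IsIrreducible ↔
        ∀ a, 1 ≤ a → a ≤ k - 1 → 0 < r a ∨ 0 < r (a + 1)) := fun r hr => by
    have h := isIrreducible_phiMatrix_transpose_iff hk hr
    exact ⟨Matrix.isIrreducible_transpose_iff.symm.trans h, h⟩
  exact ⟨fun φ hφ => key _ hφ, key⟩
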